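/- **Theorem (Distributed ETC with Exponential Performance).** Let $\mathcal G$ be a connected undirected graph on the agents $\{1,\dots,N\}$ with Laplacian $\mathbf L$. The network state is $x=(x_1,\dots,x_N)$ with $x_i\in\mathbb R^{n_i}$, and $n=\sum_i n_i$. Let $F:\mathbb R^n\times\mathbb R^m\to\mathbb R^n$ and $\kappa:\mathbb R^n\to\mathbb R^m$ be globally Lipschitz and put $f(x,e)=F(x,\kappa(x+e))$. Let $V=\sum_{i=1}^N V_i$, where each $V_i:\mathbb R^n\to\mathbb R$ depends only on the states of agent $i$ and of its neighbors, is continuously differentiable with globally Lipschitz gradient, and satisfies $\nabla V_i(0)=0$. Assume that there are positive constants $c_1,c_2,c_3,c_4$ such that, for all $x$, $$c_1\|x\|^2\le V(x)\le c_2\|x\|^2,\qquad \nabla V(x)\cdot f(x,0)\le -c_3\|x\|^2,\qquad \|\nabla V(x)\|\le c_4\|x\|.$$ (a) There are positive constants $L_f,c_\alpha,c_\gamma$ such that, for all $x,e,x',e'$, $$\|f(x,e)-f(x',e')\|\le L_f(\|x-x'\|+\|e-e'\|),\qquad \nabla V(x)\cdot f(x,e)\le -c_\alpha\|x\|^2+c_\gamma\|e\|^2.\tag{1}$$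 (b) Fix any positive constants $L_f,c_\alpha,c_\gamma$ that satisfy (1), and let $$0<r<\frac{c_\alpha}{c_2},\qquad 0<\sigma<1-\frac{rc_2}{c_\alpha},\qquad c_\beta>(1-\sigma)\frac{c_\alpha}{c_1}-r,$$ $$\tau^{d}_\sigma=\frac{q}{L_f+L_fq},\qquad q=\sqrt{\frac{(1-\sigma)c_\alpha-rc_2}{c_\gamma}} .$$ Then $\tau^d_\sigma>0$. Let $W^x(x)$ and $W^{xe}(x,e)$ be the vectors in $\mathbb R^N$ with components $$W^x_i=(\sigma-1)c_\alpha\|x_i\|^2+(r+c_\beta)V_i(x),\qquad W^{xe}_i=W^x_i+c_\gamma\|e_i\|^2 .$$ For gains $\rho_a,\rho_z>0$ and an initial state $x_0$, an *execution* of the distributed trigger consists of update times $0=t_0\le t_1\le\cdots$ in $[0,\infty]$, a state $x$ and estimates $a,z\in\mathbb R^N$, where $x$ and $z$ are continuous, $x(0)=x_0$, every entry of $z(0)$ equals $\frac1N\sum_jW^x_j(x_0)$, and between $t_k$ and $t_{k+1}$ $$\dot x=f(x,e),\quad e=x(t_k)-x,\qquad \dot z=\dot W^x-\rho_z\mathbf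 Lz,\qquad \dot a=\dot W^{xe}-\rho_a\mathbf La,$$ where $\dot W^x,\dot W^{xe}$ are the time derivatives along the execution. At each $t_k$ (including $t_0=0$) the estimate $a$ is reset by $a^+=z$, and $$t_{k+1}=\min\Big\{t\ge t_k:\ \exists i,\ a_i(t)=\tfrac{1}{N}c_\beta V(x_0)e^{-rt}\Big\},$$ with $t_{k+1}=\infty$ if this set is empty (and no further updates after that). An execution is defined for the times that lie in one of the intervals $[t_k,t_{k+1}]$. Then there are $\rho_a^*,\rho_z^*>0$, independent of $x_0$, such that for all $\rho_a\ge\rho_a^*$ and $\rho_z\ge\rho_z^*$: 1. an execution exists from every $x_0$; 2. for every $x_0\ne0$ and every execution from $x_0$, $t_{k+1}\ge t_k+\tau^d_\sigma$ for all $k\ge 0$ (so there is no Zeno behavior, and the execution is defined for all $t\ge0$), and $V(x(t))\le V(x_0)e^{-rt}$ for all $t\ge0$; 3. the origin is globally exponentially stable: $f(0,0)=0$, and there are $C,\lambda>0$ such that every execution, from every $x_0$, satisfies $\|x(t)\|\le C\|x_0\|e^{-\lambda t}$ at all times $t$ at which it is defined. -/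

import Mathlib

namespace DistributedETC

/-- The network state `x = (x_1, …, x_N)`, where agent `i` has state `x_i ∈ ℝ^{d i}`;
the norm is the Euclidean one, so `‖x‖² = ∑ i, ‖x_i‖²`. -/
abbrev NetState {N : ℕ} (d : Fin N → ℕ) : Type :=
  PiLp 2 (fun i => EuclideanSpace ℝ (Fin (d i)))

/-- The input space `ℝ^m`. -/
abbrev Input (m : ℕ) : Type := EuclideanSpace ℝ (Fin m)

variable {N m : ℕ} {d : Fin N → ℕ}

/-- The sample-and-hold dynamics `f(x, e) = F(x, κ(x + e))`, where `e = x_k - x`. -/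
def closedLoop (F : NetState d → Input m → NetState d) (κ : NetState d → Input m)
    (x e : NetState d) : NetState d :=
  F x (κ (x + e))

/-- The aggregate function `V(x) = ∑ i, V_i(x)`. -/
def aggregate (V : Fin N → NetState d → ℝ) (x : NetState d) : ℝ := ∑ i, V i x

/-- `h` depends only on the states of agent `i` and of its neighbors in `G`. -/
def IsLocalAt (G : SimpleGraph (Fin N)) (i : Fin N) (h : NetState d → ℝ) : Prop :=
  ∀ x y : NetState d, (∀ j, j = i ∨ G.Adj i j → x j = y j) → h x = h y

/-- `V` is an exponential-type Lyapunov function of `f` with constants `c₁, c₂, c₃, c₄`. -/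
structure IsExpLyapunov (f : NetState d → NetState d → NetState d) (V : NetState d → ℝ)
    (c₁ c₂ c₃ c₄ : ℝ) : Prop where
  pos₁ : 0 < c₁
  pos₂ : 0 < c₂
  pos₃ : 0 < c₃
  pos₄ : 0 < c₄
  lower : ∀ x, c₁ * ‖x‖ ^ 2 ≤ V x
  upper : ∀ x, V x ≤ c₂ * ‖x‖ ^ 2
  decay : ∀ x, fderiv ℝ V x (f x 0) ≤ -c₃ * ‖x‖ ^ 2
  grad : ∀ x, ‖fderiv ℝ V x‖ ≤ c₄ * ‖x‖

/-- `L_f` is a Lipschitz constant of `f` with respect to `(x, e)`, and `c_α, c_γ` are constants in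
the dissipation inequality `L_f V(x, e) ≤ -c_α ‖x‖² + c_γ ‖e‖²`; all of them are positive.
A Lipschitz constant with respect to the Euclidean norm of the pair `(x, e)` satisfies
`lipschitz`. -/
structure AreRateConstants (f : NetState d → NetState d → NetState d) (V : NetState d → ℝ)
    (Lf cα cγ : ℝ) : Prop where
  pos_L : 0 < Lf
  pos_α : 0 < cα
  pos_γ : 0 < cγ
  lipschitz : ∀ x e x' e', ‖f x e - f x' e'‖ ≤ Lf * (‖x - x'‖ + ‖e - e'‖)
  dissipation : ∀ x e, fderiv ℝ V x (f x e) ≤ -cα * ‖x‖ ^ 2 + cγ * ‖e‖ ^ 2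

/-- The time `τᵈ_σ` at which `φ(τ) = L_f τ / (1 - L_f τ)` satisfies
`((σ - 1) c_α + c_γ φ(τ)²) / c₂ = -r`. -/
noncomputable def tauD (Lf cα cγ c₂ σ r : ℝ) : ℝ :=
  √(((1 - σ) * cα - r * c₂) / cγ) / (Lf + Lf * √(((1 - σ) * cα - r * c₂) / cγ))

/-- The vector `W^x(x)`, with components `(σ - 1) c_α ‖x_i‖² + (r + c_β) V_i(x)`. -/
noncomputable def Wx (V : Fin N → NetState d → ℝ) (cα σ r cβ : ℝ)
    (x : NetState d) : Fin N → ℝ :=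
  fun i => (σ - 1) * cα * ‖x i‖ ^ 2 + (r + cβ) * V i x

/-- The vector `W^{xe}(x, e)`, with components `W^x_i(x) + c_γ ‖e_i‖²`. -/
noncomputable def Wxe (V : Fin N → NetState d → ℝ) (cα cγ σ r cβ : ℝ)
    (x e : NetState d) : Fin N → ℝ :=
  fun i => Wx V cα σ r cβ x i + cγ * ‖e i‖ ^ 2

/-- The closed time interval `[t_k, t_{k+1}]`, which is `[t_k, ∞)` if `t_{k+1} = ∞` and is
empty if `t_k = ∞`. -/
def timeInterval (t : ℕ → EReal) (k : ℕ) : Set ℝ :=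
  {s | t k ≤ (s : EReal) ∧ (s : EReal) ≤ t (k + 1)}

/-- An execution, from `x₀`, of the sample-and-hold system under the distributed trigger.

`t k` is the `k`-th update time (`⊤` if fewer than `k` updates occur after time `0`), `x` is the
state, `z` the estimate of the average of `W^x`, and `a k` the estimate of the average of
`W^{xe}` between `t_k` (after the jump) and `t_{k+1}` (before the jump). Derivatives at the ends
of `[t_k, t_{k+1}]` are one-sided. Nothing is required outside the union of these intervals. -/
structure Execution (G : SimpleGraph (Fin N)) [DecidableRel G.Adj]
    (F : NetState d → Input m → NetState d) (κ : NetState d → Input m)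
    (V : Fin N → NetState d → ℝ) (cα cγ σ r cβ ρa ρz : ℝ) (x₀ : NetState d) where
  t : ℕ → EReal
  x : ℝ → NetState d
  z : ℝ → Fin N → ℝ
  a : ℕ → ℝ → Fin N → ℝ
  t_zero : t 0 = 0
  t_mono : Monotone t
  x_zero : x 0 = x₀
  /-- `ẋ = f(x, e)` with `e = x(t_k) - x`. -/
  x_ode : ∀ k, ∀ s ∈ timeInterval t k,
    HasDerivWithinAt x (closedLoop F κ (x s) (x (t k).toReal - x s)) (timeInterval t k) s
  z_zero : ∀ i, z 0 i = (∑ j, Wx V cα σ r cβ x₀ j) / N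
  /-- `ż = Ẇ^x - ρ_z L z`. -/
  z_ode : ∀ k, ∀ s ∈ timeInterval t k,
    HasDerivWithinAt z
      (derivWithin (fun τ => Wx V cα σ r cβ (x τ)) (timeInterval t k) s
        - ρz • (G.lapMatrix ℝ).mulVec (z s))
      (timeInterval t k) s
  /-- The jump `a⁺ = z` at `t_k`. For `k = 0` it is the initialization of `a`. -/
  a_jump : ∀ k, ∀ s : ℝ, (s : EReal) = t k → a k s = z s
  /-- `ȧ = Ẇ^{xe} - ρ_a L a`. -/
  a_ode : ∀ k, ∀ s ∈ timeInterval t k,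
    HasDerivWithinAt (a k)
      (derivWithin (fun τ => Wxe V cα cγ σ r cβ (x τ) (x (t k).toReal - x τ))
          (timeInterval t k) s
        - ρa • (G.lapMatrix ℝ).mulVec (a k s))
      (timeInterval t k) s
  /-- `t_{k+1}` is the least `s ≥ t_k` such that `a_i(s) = c_β V(x₀) exp(-r s) / N` for some `i`,
  and is `∞` if there is none: the condition fails on `[t_k, t_{k+1})`, … -/
  no_trigger_before : ∀ k, ∀ s : ℝ, t k ≤ (s : EReal) → (s : EReal) < t (k + 1) →
    ∀ i, a k s i ≠ cβ * aggregate V x₀ * Real.exp (-r * s) / N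
  /-- … and it holds at `t_{k+1}` if this is finite. -/
  trigger_at : ∀ k, ∀ s : ℝ, (s : EReal) = t (k + 1) →
    ∃ i, a k s i = cβ * aggregate V x₀ * Real.exp (-r * s) / N

/-- The origin is globally exponentially stable under the distributed trigger: it is an
equilibrium, and all executions satisfy a common exponential bound while they are defined. -/
def GloballyExpStable (G : SimpleGraph (Fin N)) [DecidableRel G.Adj]
    (F : NetState d → Input m → NetState d) (κ : NetState d → Input m)
    (V : Fin N → NetState d → ℝ) (cα cγ σ r cβ ρa ρz : ℝ) : Prop :=
  closedLoop F κ 0 0 = 0 ∧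
    ∃ C lam : ℝ, 0 < C ∧ 0 < lam ∧
      ∀ (x₀ : NetState d) (E : Execution G F κ V cα cγ σ r cβ ρa ρz x₀) (k : ℕ),
        ∀ s ∈ timeInterval E.t k, ‖E.x s‖ ≤ C * ‖x₀‖ * Real.exp (-lam * s)

end DistributedETC

/-! Write `g(s) = V(x₀) exp(-r s)`. The sum of the entries of `W^{xe}` is `(σ - 1) c_α ‖x‖² + (r +
c_β) V + c_γ ‖e‖²`, so dissipation bounds the derivative of `V` by that sum minus `(r + c_β) V`.
While the sum is at most `c_β g`, the difference `u = V - g` satisfies `u' ≤ -(r + c_β) u`, and `V ≤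
g` persists (`value_le`). The Laplacian preserves sums and `W^{xe} = W^x` when `e = 0`, so the
entries of `a` always add up to the sum of `W^{xe}`. By continuity no entry exceeds the threshold
before a trigger, hence the decay estimate holds whatever the consensus error is.

The gains matter only for the dwell time. For a time `τᵈ_σ` after an update `‖e‖ ≤ q ‖x‖`
(`error_le`), and then the sum stays below `c_β g` by a fixed fraction of `g`, the `margin`
(`sum_Wxe_le`). It remains to keep each entry of `a` within half of `margin * g / N` of the average.
The reference signals have derivatives quadratic in `(x, e)`, hence at most a constant times `g`.
The spectral gap of the connected graph therefore keeps the spread below a fixed multiple of `g²`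
once the gain is large (`spread_le_of_consensus`). Every bound scales with `g`, which makes the
gains independent of `x₀`. `invariant_of_phase` joins these facts on one interval, and the invariant
passes from each interval to the next.

Existence is separate and needs no large gain: the flow between updates is global, and updates are
iterated. -/

namespace DistributedETC
open Set Filter Topology NNReal Metric

/-! ### Global solutions of Lipschitz differential equations -/

section ODE
variable {E : Type*} [NormedAddCommGroup E] [NormedSpace ℝ E] [CompleteSpace E]

/-- A vector field with global Lipschitz constant `K` has a solution on every interval of length
`(2 K + 1)⁻¹`, whatever the initial value. -/
theorem exists_solution_Icc_of_lipschitz {v : ℝ → E → E} {K : ℝ≥0}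
    (hv : ∀ t, LipschitzWith K (v t)) (hc : ∀ y, Continuous (fun t => v t y)) (b : ℝ) (y₀ : E) :
    ∃ y : ℝ → E, y b = y₀ ∧ ∀ s ∈ Icc b (b + (2 * K + 1 : ℝ)⁻¹),
      HasDerivWithinAt y (v s (y s)) (Icc b (b + (2 * K + 1 : ℝ)⁻¹)) s := by
  set h : ℝ := (2 * K + 1 : ℝ)⁻¹ with hh
  have hpos : 0 < h := by positivity
  obtain ⟨M, hM⟩ := (isCompact_Icc (a := b) (b := b + h)).exists_bound_of_continuousOn
    (hc y₀).continuousOn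
  have hM0 : 0 ≤ M := (norm_nonneg _).trans (hM b ⟨le_rfl, by linarith⟩)
  -- On the ball of radius `2 h M` the field is at most `M + 2 K h M ≤ 2 M`, because `K h ≤ 1 / 2`;
  -- a solution cannot leave the ball within time `h`.
  have key : IsPicardLindelof v (⟨b, le_rfl, by linarith⟩ : Icc b (b + h)) y₀
      (⟨2 * h * M, by positivity⟩ : ℝ≥0) 0 (⟨M + K * (2 * h * M), by positivity⟩ : ℝ≥0) K := by
    refine ⟨fun t _ => (hv t).lipschitzOnWith, fun y _ => (hc y).continuousOn, ?_, ?_⟩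
    · intro t ht y hy
      have h1 : ‖v t y - v t y₀‖ ≤ K * ‖y - y₀‖ := by
        simpa [dist_eq_norm] using (hv t).dist_le_mul y y₀
      have h2 : ‖y - y₀‖ ≤ 2 * h * M := mem_closedBall_iff_norm.1 hy
      have h3 : ‖v t y‖ ≤ ‖v t y₀‖ + ‖v t y - v t y₀‖ := norm_le_norm_add_norm_sub' _ _
      have h4 := hM t ht
      have h5 : (K : ℝ) * ‖y - y₀‖ ≤ K * (2 * h * M) := by gcongr
      show ‖v t y‖ ≤ M + K * (2 * h * M)
      linarith
    · have h1 : (2 * K + 1 : ℝ) * h = 1 := by rw [hh]; exact mul_inv_cancel₀ (by positivity)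
      have h2 : (K : ℝ) * h ≤ 1 / 2 := by nlinarith
      show (M + K * (2 * h * M)) * max (b + h - b) (b - b) ≤ 2 * h * M - 0
      rw [add_sub_cancel_left, sub_self, max_eq_left hpos.le]
      have : 0 ≤ M * h := by positivity
      nlinarith
  exact key.exists_eq_forall_mem_Icc_hasDerivWithinAt₀

/-- The length gained does not depend on the solution being extended, so repeated extension covers a
half-line. -/
theorem exists_extension_of_lipschitz {v : ℝ → E → E} {K : ℝ≥0}
    (hv : ∀ t, LipschitzWith K (v t)) (hc : ∀ y, Continuous (fun t => v t y)) {a b : ℝ}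
    (hab : a ≤ b) (y : ℝ → E)
    (hy : ∀ s ∈ Icc a b, HasDerivWithinAt y (v s (y s)) (Icc a b) s) :
    ∃ y' : ℝ → E, EqOn y' y (Icc a b) ∧ ∀ s ∈ Icc a (b + (2 * K + 1 : ℝ)⁻¹),
      HasDerivWithinAt y' (v s (y' s)) (Icc a (b + (2 * K + 1 : ℝ)⁻¹)) s := by
  obtain ⟨w, hw0, hw⟩ := exists_solution_Icc_of_lipschitz hv hc b (y b)
  set h : ℝ := (2 * K + 1 : ℝ)⁻¹ with hh
  have hpos : 0 < h := by positivity
  set y' : ℝ → E := fun s => if s ≤ b then y s else w s with hy'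
  have e1 : EqOn y' y (Icc a b) := fun s hs => by simp [hy', hs.2]
  have e2 : EqOn y' w (Icc b (b + h)) := fun s hs => by
    rcases hs.1.eq_or_lt with rfl | h'
    · simp [hy', hw0]
    · simp [hy', not_le.2 h']
  have d1 : ∀ s ∈ Icc a b, HasDerivWithinAt y' (v s (y' s)) (Icc a b) s := fun s hs => by
    rw [e1 hs]; exact (hy s hs).congr e1 (e1 hs)
  have d2 : ∀ s ∈ Icc b (b + h), HasDerivWithinAt y' (v s (y' s)) (Icc b (b + h)) s :=
    fun s hs => by rw [e2 hs]; exact (hw s hs).congr e2 (e2 hs)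
  refine ⟨y', e1, fun s hs => ?_⟩
  have hu : Icc a (b + h) = Icc a b ∪ Icc b (b + h) :=
    (Icc_union_Icc_eq_Icc hab (by linarith)).symm
  rcases lt_trichotomy s b with hsb | rfl | hsb
  · refine (d1 s ⟨hs.1, hsb.le⟩).mono_of_mem_nhdsWithin ?_
    filter_upwards [self_mem_nhdsWithin, mem_nhdsWithin_of_mem_nhds (Iio_mem_nhds hsb)] with u h1 h2
    exact ⟨h1.1, h2.le⟩
  · rw [hu]
    exact (d1 s ⟨hs.1, le_rfl⟩).union (d2 s ⟨le_rfl, hs.2⟩)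
  · refine (d2 s ⟨hsb.le, hs.2⟩).mono_of_mem_nhdsWithin ?_
    filter_upwards [self_mem_nhdsWithin, mem_nhdsWithin_of_mem_nhds (Ioi_mem_nhds hsb)] with u h1 h2
    exact ⟨h2.le, h1.2⟩

/-- Forward global existence for a globally Lipschitz vector field. -/
theorem exists_global_solution_of_lipschitz {v : ℝ → E → E} {K : ℝ≥0}
    (hv : ∀ t, LipschitzWith K (v t)) (hc : ∀ y, Continuous (fun t => v t y)) (a : ℝ) (y₀ : E) :
    ∃ y : ℝ → E, y a = y₀ ∧ ∀ s ∈ Ici a, HasDerivWithinAt y (v s (y s)) (Ici a) s := by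
  set h : ℝ := (2 * K + 1 : ℝ)⁻¹ with hh
  have hpos : 0 < h := by positivity
  let S (n : ℕ) : Type _ :=
    {y : ℝ → E // ∀ s ∈ Icc a (a + n * h), HasDerivWithinAt y (v s (y s)) (Icc a (a + n * h)) s}
  have step : ∀ n (y : S n), ∃ y' : S (n + 1), EqOn y'.1 y.1 (Icc a (a + n * h)) := by
    intro n y
    obtain ⟨y', h1, h2⟩ := exists_extension_of_lipschitz hv hc
      (le_add_of_nonneg_right (by positivity)) y.1 y.2
    refine ⟨⟨y', ?_⟩, h1⟩
    have : a + (n + 1 : ℕ) * h = a + n * h + (2 * K + 1 : ℝ)⁻¹ := by push_cast; ring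
    rw [this]; exact h2
  choose next hnext using step
  let Y : ∀ n, S n := fun n => Nat.rec
    ⟨fun _ => y₀, fun s hs => by
      have : Icc a (a + ((0 : ℕ) : ℝ) * h) = {a} := by simp
      rw [this] at hs ⊢
      obtain rfl : s = a := hs
      exact HasFDerivWithinAt.of_subsingleton subsingleton_singleton⟩ (fun n y => next n y) n
  have hY : ∀ n, EqOn (Y (n + 1)).1 (Y n).1 (Icc a (a + n * h)) := fun n => hnext n (Y n)
  have hYm : ∀ n k, EqOn (Y (n + k)).1 (Y n).1 (Icc a (a + n * h)) := by
    intro n k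
    induction k with
    | zero => exact fun _ _ => rfl
    | succ k ih =>
      intro s hs
      rw [← ih hs]
      refine hY (n + k) ⟨hs.1, hs.2.trans ?_⟩
      push_cast; nlinarith [(Nat.cast_nonneg k : (0 : ℝ) ≤ k)]
  -- The `+ 1` puts `s` strictly before the end of its interval, so the derivative there is also one
  -- within `Ici a`.
  set I : ℝ → ℕ := fun s => ⌊(s - a) / h⌋₊ + 1 with hI
  have hIlt : ∀ s, s < a + I s * h := fun s => by
    have := Nat.lt_floor_add_one ((s - a) / h)
    rw [div_lt_iff₀ hpos] at this
    simp only [hI]; push_cast; linarith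
  set y : ℝ → E := fun s => (Y (I s)).1 s with hy
  have hyY : ∀ n, EqOn y (Y n).1 (Icc a (a + n * h)) := by
    intro n s hs
    rcases le_total (I s) n with hn | hn
    · obtain ⟨k, rfl⟩ := Nat.exists_eq_add_of_le hn
      exact (hYm (I s) k ⟨hs.1, (hIlt s).le⟩).symm
    · obtain ⟨k, hk⟩ := Nat.exists_eq_add_of_le hn
      simp only [hy]; rw [hk]
      exact hYm n k hs
  refine ⟨y, ?_, fun s hs => ?_⟩
  · exact hyY 0 (by simp)
  · have hm : s ∈ Icc a (a + I s * h) := ⟨hs, (hIlt s).le⟩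
    have h1 := ((Y (I s)).2 s hm).congr (hyY (I s)) (hyY (I s) hm)
    rw [← hyY (I s) hm] at h1
    refine h1.mono_of_mem_nhdsWithin ?_
    filter_upwards [self_mem_nhdsWithin, mem_nhdsWithin_of_mem_nhds (Iio_mem_nhds (hIlt s))]
      with u h1 h2
    exact ⟨h1, h2.le⟩

end ODE

/-! ### Differential inequalities -/

section Comparison

/-- If `u' ≤ -k u` on `[a, b]` and `u a ≤ 0`, then `u ≤ 0` on `[a, b]`. -/
theorem nonpos_of_deriv_le_neg_mul {u u' : ℝ → ℝ} {a b k : ℝ}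
    (hu : ∀ s ∈ Icc a b, HasDerivWithinAt u (u' s) (Icc a b) s)
    (hle : ∀ s ∈ Icc a b, u' s ≤ -k * u s) (ha : u a ≤ 0) : ∀ s ∈ Icc a b, u s ≤ 0 := by
  have hd : ∀ s ∈ Icc a b, HasDerivWithinAt (fun s => u s * Real.exp (k * s))
      (u' s * Real.exp (k * s) + u s * (Real.exp (k * s) * k)) (Icc a b) s := fun s hs => by
    have h1 : HasDerivAt (fun s : ℝ => Real.exp (k * s)) (Real.exp (k * s) * k) s := by
      simpa using ((hasDerivAt_id s).const_mul k).exp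
    exact (hu s hs).mul h1.hasDerivWithinAt
  have hanti : AntitoneOn (fun s => u s * Real.exp (k * s)) (Icc a b) := by
    refine antitoneOn_of_hasDerivWithinAt_nonpos (convex_Icc a b)
      (fun s hs => (hd s hs).continuousWithinAt)
      (fun s hs => (hd s (interior_subset hs)).mono interior_subset) (fun s hs => ?_)
    have := hle s (interior_subset hs)
    nlinarith [Real.exp_pos (k * s)]
  intro s hs
  have h1 : u s * Real.exp (k * s) ≤ u a * Real.exp (k * a) :=
    hanti ⟨le_rfl, hs.1.trans hs.2⟩ hs hs.1
  have h2 : u a * Real.exp (k * a) ≤ 0 := mul_nonpos_of_nonpos_of_nonneg ha (Real.exp_pos _).le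
  by_contra hc
  push Not at hc
  have := mul_pos hc (Real.exp_pos (k * s))
  linarith

/-- If the state moves with speed at most `L (‖x‖ + ‖e‖)`, where `e = x(a) - x`, then
`‖e‖ ≤ L (s - a) (‖x‖ + ‖e‖)`. -/
theorem norm_error_le {E : Type*} [NormedAddCommGroup E] [NormedSpace ℝ E]
    {x x' : ℝ → E} {a b L : ℝ} (hL : 0 ≤ L) (hb : L * (b - a) ≤ 1)
    (hx : ∀ s ∈ Icc a b, HasDerivWithinAt x (x' s) (Icc a b) s)
    (hle : ∀ s ∈ Icc a b, ‖x' s‖ ≤ L * (‖x s‖ + ‖x a - x s‖)) :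
    ∀ s ∈ Icc a b, ‖x a - x s‖ ≤ L * (s - a) * (‖x s‖ + ‖x a - x s‖) := by
  have hxc : ContinuousOn x (Icc a b) := fun s hs => (hx s hs).continuousWithinAt
  have key := image_le_of_liminf_slope_right_le_deriv_boundary
    (f := fun s => ‖x a - x s‖ - L * (s - a) * (‖x s‖ + ‖x a - x s‖)) (a := a) (b := b)
    (B := fun _ => 0) (B' := fun _ => 0) (by fun_prop) (by simp) continuousOn_const
    (fun s _ => hasDerivWithinAt_const _ _ _) ?_
  · intro s hs; have := key hs; linarith
  intro s hs r hr
  have hs' : s ∈ Icc a b := ⟨hs.1, hs.2.le⟩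
  have hd : HasDerivWithinAt x (x' s) (Ioi s) s :=
    (hx s hs').mono_of_mem_nhdsWithin (mem_of_superset (Ioc_mem_nhdsGT hs.2)
      fun u hu => ⟨hs.1.trans hu.1.le, hu.2⟩)
  have hev := hd.limsup_norm_slope_le (r := L * (‖x s‖ + ‖x a - x s‖) + r)
    (by linarith [hle s hs'])
  refine Eventually.frequently ?_
  filter_upwards [hev, Ioc_mem_nhdsGT hs.2] with u hu hub
  have hpos : 0 < u - s := by linarith [hub.1]
  rw [slope_def_field, div_lt_iff₀ hpos]
  rw [Real.norm_eq_abs, abs_of_pos hpos, inv_mul_lt_iff₀ hpos] at hu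
  have t1 : ‖x a - x u‖ - ‖x a - x s‖ ≤ ‖x u - x s‖ := by
    have := norm_sub_norm_le (x a - x u) (x a - x s)
    have h2 : x a - x u - (x a - x s) = -(x u - x s) := by abel
    rwa [h2, norm_neg] at this
  have t2 : ‖x s‖ - ‖x u‖ ≤ ‖x u - x s‖ := by
    have := norm_sub_norm_le (x s) (x u)
    rwa [norm_sub_rev] at this
  -- The increments of `‖e‖` and of `-‖x‖` enter with weights `1 - L (u - a)` and `L (u - a)`. These
  -- are nonnegative with sum one, so together they contribute at most `‖x u - x s‖`.
  have c1 : 0 ≤ L * (u - a) := mul_nonneg hL (by linarith [hub.1, hs.1])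
  have c2 : 0 ≤ 1 - L * (u - a) := by nlinarith [hub.2]
  nlinarith [mul_le_mul_of_nonneg_left t1 c2, mul_le_mul_of_nonneg_left t2 c1]

end Comparison
end DistributedETC

/-! ### Dynamic average consensus -/

namespace DistributedETC
open Set Matrix

section Consensus
variable {N : ℕ} (G : SimpleGraph (Fin N)) [DecidableRel G.Adj]

/-- The sum of the squared deviations from the average. -/
noncomputable def spread (y : Fin N → ℝ) : ℝ := ∑ i, (y i - (∑ j, y j) / N) ^ 2

theorem sum_sub_average (y : Fin N → ℝ) : ∑ i, (y i - (∑ j, y j) / N) = 0 := by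
  rcases Nat.eq_zero_or_pos N with rfl | hN
  · simp
  · have : (N : ℝ) ≠ 0 := by positivity
    simp [Finset.sum_sub_distrib]
    field_simp
    simp

theorem sum_lapMatrix_mulVec (y : Fin N → ℝ) : ∑ i, (G.lapMatrix ℝ *ᵥ y) i = 0 := by
  have h1 : ∑ i, (G.lapMatrix ℝ *ᵥ y) i = (fun _ => (1 : ℝ)) ⬝ᵥ (G.lapMatrix ℝ *ᵥ y) := by
    simp [dotProduct]
  rw [h1, dotProduct_mulVec, ← mulVec_transpose, (G.isSymm_lapMatrix (R := ℝ)).eq,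
    G.lapMatrix_mulVec_const_eq_zero, zero_dotProduct]

/-- The spectral gap of the Laplacian of a connected graph. -/
theorem exists_spectral_gap (hG : G.Connected) :
    ∃ gap : ℝ, 0 < gap ∧ ∀ δ : Fin N → ℝ, ∑ i, δ i = 0 →
      gap * ∑ i, δ i ^ 2 ≤ δ ⬝ᵥ (G.lapMatrix ℝ *ᵥ δ) := by
  set Q : (Fin N → ℝ) → ℝ := fun δ => δ ⬝ᵥ (G.lapMatrix ℝ *ᵥ δ) with hQ
  have hQ2 : ∀ δ, Q δ = (∑ i, ∑ j, if G.Adj i j then (δ i - δ j) ^ 2 else 0) / 2 := fun δ => by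
    rw [hQ, ← G.lapMatrix_toLinearMap₂' ℝ, toLinearMap₂'_apply']
  have hQ0 : ∀ δ, 0 ≤ Q δ := fun δ => by
    rw [hQ2]
    refine div_nonneg (Finset.sum_nonneg fun i _ => Finset.sum_nonneg fun j _ => ?_) two_pos.le
    split_ifs <;> positivity
  have hQc : Continuous Q := by
    rw [funext hQ2]
    refine Continuous.div_const (continuous_finsetSum _ fun i _ =>
      continuous_finsetSum _ fun j _ => ?_) _
    split_ifs <;> fun_prop
  set S : Set (Fin N → ℝ) := {δ | ∑ i, δ i = 0 ∧ ∑ i, δ i ^ 2 = 1} with hS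
  have hSc : IsCompact S := by
    refine (isCompact_closedBall (0 : Fin N → ℝ) 1).of_isClosed_subset ?_ ?_
    · exact (isClosed_eq (by fun_prop) continuous_const).inter
        (isClosed_eq (by fun_prop) continuous_const)
    · intro δ hδ
      rw [mem_closedBall_zero_iff, pi_norm_le_iff_of_nonneg zero_le_one]
      intro i
      have h1 : δ i ^ 2 ≤ ∑ i, δ i ^ 2 :=
        Finset.single_le_sum (f := fun i => δ i ^ 2) (fun i _ => sq_nonneg _) (Finset.mem_univ i)
      rw [hδ.2] at h1
      exact abs_le_one_iff_mul_self_le_one.2 (by nlinarith)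
  have hscale : ∀ gap : ℝ, (∀ δ ∈ S, gap ≤ Q δ) → ∀ δ : Fin N → ℝ, ∑ i, δ i = 0 →
      gap * ∑ i, δ i ^ 2 ≤ Q δ := by
    intro gap hgap δ hδ
    set n2 := ∑ i, δ i ^ 2 with hn2
    have hn : 0 ≤ n2 := Finset.sum_nonneg fun i _ => sq_nonneg _
    rcases hn.eq_or_lt with h0 | hpos
    · rw [← h0, mul_zero]; exact hQ0 δ
    · have hsq : √n2 ^ 2 = n2 := Real.sq_sqrt hn
      have hs : 0 < √n2 := Real.sqrt_pos.2 hpos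
      have hm : (√n2)⁻¹ • δ ∈ S := by
        constructor
        · simp [← Finset.mul_sum, hδ]
        · simp only [Pi.smul_apply, smul_eq_mul, mul_pow, ← Finset.mul_sum, ← hn2, inv_pow, hsq]
          exact inv_mul_cancel₀ hpos.ne'
      have h1 := hgap _ hm
      have h2 : Q ((√n2)⁻¹ • δ) = n2⁻¹ * Q δ := by
        simp only [hQ, mulVec_smul, smul_dotProduct, dotProduct_smul, smul_eq_mul, ← mul_assoc]
        rw [← mul_inv, ← sq, hsq]
      rw [h2, inv_mul_eq_div, le_div_iff₀ hpos] at h1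
      exact h1
  -- The slice is empty for a single agent, and then any constant serves as the gap.
  rcases S.eq_empty_or_nonempty with hSe | hSn
  · exact ⟨1, one_pos, hscale 1 (by simp [hSe])⟩
  · obtain ⟨δ, hδ, hmin⟩ := hSc.exists_isMinOn hSn hQc.continuousOn
    refine ⟨Q δ, (hQ0 δ).lt_of_ne fun h0 => ?_, hscale _ fun y hy => hmin hy⟩
    -- A minimizer with zero energy is constant by connectedness, hence zero because its sum
    -- vanishes, against its unit norm.
    have h1 := (G.lapMatrix_toLinearMap₂'_apply'_eq_zero_iff_forall_reachable δ).1
      (by rw [toLinearMap₂'_apply']; exact h0.symm)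
    obtain ⟨i₀⟩ := hG.nonempty
    have hconst : ∀ i, δ i = δ i₀ := fun i => h1 _ _ (hG.preconnected i i₀)
    have hN : (N : ℝ) ≠ 0 := by
      have := i₀.pos
      positivity
    have h2 := hδ.1
    simp only [hconst, Finset.sum_const, Finset.card_univ, Fintype.card_fin, nsmul_eq_mul,
      mul_eq_zero, hN, false_or] at h2
    have h3 := hδ.2
    simp [hconst, h2] at h3

/-- The Laplacian annihilates constants, so subtracting the average does not change its value. -/
theorem gap_mul_spread_le {gap : ℝ}
    (hgap : ∀ δ : Fin N → ℝ, ∑ i, δ i = 0 →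
      gap * ∑ i, δ i ^ 2 ≤ δ ⬝ᵥ (G.lapMatrix ℝ *ᵥ δ)) (y : Fin N → ℝ) :
    gap * spread y ≤ ∑ i, (y i - (∑ j, y j) / N) * (G.lapMatrix ℝ *ᵥ y) i := by
  have h := hgap _ (sum_sub_average y)
  have h2 : G.lapMatrix ℝ *ᵥ (fun i => y i - (∑ j, y j) / N) = G.lapMatrix ℝ *ᵥ y := by
    have : (fun i => y i - (∑ j, y j) / N) = y - ((∑ j, y j) / N) • (fun _ : Fin N => (1 : ℝ)) := by
      ext i; simp
    rw [this, mulVec_sub, mulVec_smul, G.lapMatrix_mulVec_const_eq_zero]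
    simp
  rw [h2] at h
  exact h

/-- Dynamic average consensus preserves the average. -/
theorem sum_eq_of_consensus {y w w' : ℝ → Fin N → ℝ} {a b ρ : ℝ}
    (hw : ∀ s ∈ Icc a b, HasDerivWithinAt w (w' s) (Icc a b) s)
    (hy : ∀ s ∈ Icc a b,
      HasDerivWithinAt y (w' s - ρ • (G.lapMatrix ℝ).mulVec (y s)) (Icc a b) s)
    (ha : ∑ i, y a i = ∑ i, w a i) : ∀ s ∈ Icc a b, ∑ i, y s i = ∑ i, w s i := by
  intro s hs
  have hd : ∀ u ∈ Icc a b, HasDerivWithinAt (fun u => ∑ i, (y u i - w u i)) 0 (Icc a b) u := by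
    intro u hu
    have h := HasDerivWithinAt.fun_sum (u := Finset.univ) fun i _ =>
      ((hasDerivWithinAt_pi.1 (hy u hu) i).fun_sub (hasDerivWithinAt_pi.1 (hw u hu) i))
    refine h.congr_deriv ?_
    simp [← Finset.mul_sum, sum_lapMatrix_mulVec]
  have hc : ∀ u ∈ Icc a b, ∑ i, (y u i - w u i) = ∑ i, (y a i - w a i) :=
    constant_of_derivWithin_zero (fun u hu => (hd u hu).differentiableWithinAt)
      fun u hu => (hd u ⟨hu.1, hu.2.le⟩).derivWithin
        (uniqueDiffOn_Icc (hu.1.trans_lt hu.2) u ⟨hu.1, hu.2.le⟩)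
  have := hc s hs
  simp only [Finset.sum_sub_distrib] at this
  linarith

/-- Dynamic average consensus keeps an exponentially decaying bound on the deviation from the
average, if the gain is large enough. -/
theorem spread_le_of_consensus {y w' : ℝ → Fin N → ℝ} {a b ρ gap C β r g : ℝ} (hgap0 : 0 < gap)
    (hgap : ∀ δ : Fin N → ℝ, ∑ i, δ i = 0 →
      gap * ∑ i, δ i ^ 2 ≤ δ ⬝ᵥ (G.lapMatrix ℝ *ᵥ δ))
    (hρ0 : 0 < ρ) (hρ : N * C ^ 2 / (ρ * gap) + 2 * r * β ≤ ρ * gap * β)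
    (hy : ∀ s ∈ Icc a b,
      HasDerivWithinAt y (w' s - ρ • (G.lapMatrix ℝ).mulVec (y s)) (Icc a b) s)
    (hw : ∀ s ∈ Icc a b, ∀ i, |w' s i| ≤ C * (g * Real.exp (-r * s)))
    (ha : spread (y a) ≤ β * (g * Real.exp (-r * a)) ^ 2) :
    ∀ s ∈ Icc a b, spread (y s) ≤ β * (g * Real.exp (-r * s)) ^ 2 := by
  have hk : 0 < ρ * gap := mul_pos hρ0 hgap0
  have hE : ∀ s ∈ Icc a b, HasDerivWithinAt (fun s => spread (y s))
      (2 * ∑ i, (y s i - (∑ j, y s j) / N) * (w' s i - ρ * (G.lapMatrix ℝ *ᵥ y s) i))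
      (Icc a b) s := by
    intro s hs
    have hyi := fun i => hasDerivWithinAt_pi.1 (hy s hs) i
    have hsum := (HasDerivWithinAt.fun_sum (u := Finset.univ) fun i _ => hyi i).div_const (N : ℝ)
    have h := HasDerivWithinAt.fun_sum (u := Finset.univ) fun i _ =>
      ((hyi i).fun_sub hsum).fun_pow 2
    refine h.congr_deriv ?_
    generalize (∑ i, (w' s - ρ • (G.lapMatrix ℝ).mulVec (y s)) i) / (N : ℝ) = c
    -- The motion of the average drops out, since the deviations add up to zero.
    have h0 : ∑ i, (y s i - (∑ j, y s j) / N) * c = 0 := by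
      rw [← Finset.sum_mul, sum_sub_average, zero_mul]
    rw [← sub_zero (∑ i, _), ← mul_zero (-2), ← h0, Finset.mul_sum, Finset.mul_sum,
      ← Finset.sum_sub_distrib]
    refine Finset.sum_congr rfl fun i _ => ?_
    simp only [Pi.sub_apply, Pi.smul_apply, smul_eq_mul]
    push_cast
    ring
  have hg : ∀ s, HasDerivAt (fun s => β * (g * Real.exp (-r * s)) ^ 2)
      (-(2 * r) * (β * (g * Real.exp (-r * s)) ^ 2)) s := by
    intro s
    have h1 : HasDerivAt (fun s : ℝ => Real.exp (-r * s)) (Real.exp (-r * s) * -r) s := by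
      simpa using ((hasDerivAt_id s).const_mul (-r)).exp
    refine (((h1.const_mul g).fun_pow 2).const_mul β).congr_deriv ?_
    ring
  have key := nonpos_of_deriv_le_neg_mul (k := ρ * gap)
    (fun s hs => (hE s hs).fun_sub (hg s).hasDerivWithinAt) ?_ (by linarith)
  · intro s hs; linarith [key s hs]
  intro s hs
  set e := g * Real.exp (-r * s)
  have h1 := gap_mul_spread_le G hgap (y s)
  -- Young's inequality spends half of the damping `2 ρ gap` on the input; the other half is the
  -- rate used in `key`.
  have h2 : ∀ i, 2 * ((y s i - (∑ j, y s j) / N) * w' s i) ≤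
      ρ * gap * (y s i - (∑ j, y s j) / N) ^ 2 + (C * e) ^ 2 / (ρ * gap) := by
    intro i
    have h3 : w' s i ^ 2 ≤ (C * e) ^ 2 := sq_le_sq' (by linarith [(abs_le.1 (hw s hs i)).1])
      (abs_le.1 (hw s hs i)).2
    have h4 : w' s i ^ 2 / (ρ * gap) ≤ (C * e) ^ 2 / (ρ * gap) := by gcongr
    have h5 : w' s i ^ 2 / (ρ * gap) * (ρ * gap) = w' s i ^ 2 := div_mul_cancel₀ _ hk.ne'
    set p := w' s i ^ 2 / (ρ * gap)
    set δ := y s i - (∑ j, y s j) / N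
    have h6 : 2 * (δ * w' s i) ≤ ρ * gap * δ ^ 2 + p := by
      have : 0 ≤ (ρ * gap * δ - w' s i) ^ 2 := sq_nonneg _
      have h7 : 0 ≤ (ρ * gap) * (ρ * gap * δ ^ 2 + p - 2 * (δ * w' s i)) := by nlinarith
      linarith [nonneg_of_mul_nonneg_right h7 hk]
    linarith
  have h3 := Finset.sum_le_sum fun i (_ : i ∈ Finset.univ) => h2 i
  rw [← Finset.mul_sum, Finset.sum_add_distrib, ← Finset.mul_sum] at h3
  simp only [Finset.sum_const, Finset.card_univ, Fintype.card_fin, nsmul_eq_mul] at h3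
  have h4 : 2 * ∑ i, (y s i - (∑ j, y s j) / N) * (w' s i - ρ * (G.lapMatrix ℝ *ᵥ y s) i) =
      2 * ∑ i, (y s i - (∑ j, y s j) / N) * w' s i -
      2 * ρ * ∑ i, (y s i - (∑ j, y s j) / N) * (G.lapMatrix ℝ *ᵥ y s) i := by
    rw [Finset.mul_sum, Finset.mul_sum, Finset.mul_sum, ← Finset.sum_sub_distrib]
    exact Finset.sum_congr rfl fun i _ => by ring
  have h5 : (N * C ^ 2 / (ρ * gap) + 2 * r * β) * e ^ 2 ≤ ρ * gap * β * e ^ 2 :=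
    mul_le_mul_of_nonneg_right hρ (sq_nonneg _)
  have h6 : (N : ℝ) * ((C * e) ^ 2 / (ρ * gap)) = N * C ^ 2 / (ρ * gap) * e ^ 2 := by ring
  rw [h4]
  change _ ≤ -(ρ * gap) * (spread (y s) - β * e ^ 2)
  have h7 : ∑ i, (y s i - (∑ j, y s j) / N) ^ 2 = spread (y s) := rfl
  rw [h7, h6] at h3
  have h8 := mul_le_mul_of_nonneg_left h1 hρ0.le
  linarith

theorem le_average_add_sqrt_spread (y : Fin N → ℝ) {B : ℝ} (hB : 0 ≤ B)
    (hy : spread y ≤ B ^ 2) (i : Fin N) : y i ≤ (∑ j, y j) / N + B := by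
  have h1 : (y i - (∑ j, y j) / N) ^ 2 ≤ spread y :=
    Finset.single_le_sum (f := fun i => (y i - (∑ j, y j) / N) ^ 2) (fun i _ => sq_nonneg _)
      (Finset.mem_univ i)
  have := abs_le_of_sq_le_sq' (h1.trans hy) hB
  linarith [this.2]

end Consensus
end DistributedETC

/-! ### The vectors `W^x` and `W^{xe}`, and consequences of the Lyapunov hypotheses -/

namespace DistributedETC
open Set Filter Topology NNReal

variable {N m : ℕ} {d : Fin N → ℕ}

/-- The derivative of `W^x` in the direction `v`. -/
noncomputable def dWx (V : Fin N → NetState d → ℝ) (cα σ r cβ : ℝ)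
    (x v : NetState d) : Fin N → ℝ :=
  fun i => (σ - 1) * cα * (2 * inner ℝ (x i) (v i)) + (r + cβ) * fderiv ℝ (V i) x v

/-- The derivative of `W^{xe}` when `x` moves with velocity `v` and `e` with velocity `-v`. -/
noncomputable def dWxe (V : Fin N → NetState d → ℝ) (cα cγ σ r cβ : ℝ)
    (x e v : NetState d) : Fin N → ℝ :=
  fun i => dWx V cα σ r cβ x v i + cγ * (2 * inner ℝ (e i) (-v i))

theorem hasDerivWithinAt_coord {x : ℝ → NetState d} {v : NetState d} {S : Set ℝ} {s : ℝ}
    (hx : HasDerivWithinAt x v S s) (i : Fin N) :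
    HasDerivWithinAt (fun τ => x τ i) (v i) S s :=
  (PiLp.proj (𝕜 := ℝ) 2 (fun i => EuclideanSpace ℝ (Fin (d i))) i).hasFDerivAt.comp_hasDerivWithinAt
    s hx

theorem hasDerivWithinAt_Wx {V : Fin N → NetState d → ℝ} (hV : ∀ i, Differentiable ℝ (V i))
    (cα σ r cβ : ℝ) {x : ℝ → NetState d} {v : NetState d} {S : Set ℝ} {s : ℝ}
    (hx : HasDerivWithinAt x v S s) :
    HasDerivWithinAt (fun τ => Wx V cα σ r cβ (x τ)) (dWx V cα σ r cβ (x s) v) S s := by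
  refine hasDerivWithinAt_pi.2 fun i => ?_
  exact ((hasDerivWithinAt_coord hx i).norm_sq.const_mul _).fun_add
    (((hV i (x s)).hasFDerivAt.comp_hasDerivWithinAt s hx).const_mul _)

theorem hasDerivWithinAt_Wxe {V : Fin N → NetState d → ℝ} (hV : ∀ i, Differentiable ℝ (V i))
    (cα cγ σ r cβ : ℝ) {x : ℝ → NetState d} {v : NetState d} {S : Set ℝ} {s : ℝ}
    (hx : HasDerivWithinAt x v S s) (p : NetState d) :
    HasDerivWithinAt (fun τ => Wxe V cα cγ σ r cβ (x τ) (p - x τ))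
      (dWxe V cα cγ σ r cβ (x s) (p - x s) v) S s := by
  refine hasDerivWithinAt_pi.2 fun i => ?_
  exact (hasDerivWithinAt_pi.1 (hasDerivWithinAt_Wx hV cα σ r cβ hx) i).fun_add
    (((hasDerivWithinAt_coord hx i).const_sub (p i)).norm_sq.const_mul _)

theorem differentiable_aggregate {V : Fin N → NetState d → ℝ}
    (hV : ∀ i, Differentiable ℝ (V i)) : Differentiable ℝ (aggregate V) :=
  Differentiable.fun_sum fun i _ => hV i

theorem sum_norm_sq (x : NetState d) : ∑ i, ‖x i‖ ^ 2 = ‖x‖ ^ 2 :=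
  (PiLp.norm_sq_eq_of_L2 _ x).symm

theorem sum_Wx (V : Fin N → NetState d → ℝ) (cα σ r cβ : ℝ) (x : NetState d) :
    ∑ i, Wx V cα σ r cβ x i = (σ - 1) * cα * ‖x‖ ^ 2 + (r + cβ) * aggregate V x := by
  simp only [Wx, Finset.sum_add_distrib, ← Finset.mul_sum, sum_norm_sq, aggregate]

theorem sum_Wxe (V : Fin N → NetState d → ℝ) (cα cγ σ r cβ : ℝ) (x e : NetState d) :
    ∑ i, Wxe V cα cγ σ r cβ x e i =
      (σ - 1) * cα * ‖x‖ ^ 2 + (r + cβ) * aggregate V x + cγ * ‖e‖ ^ 2 := by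
  simp only [Wxe, Finset.sum_add_distrib, sum_Wx, ← Finset.mul_sum, sum_norm_sq]

/-- A Lipschitz gradient that vanishes at the origin grows at most linearly. Applied to each `V i`,
this makes the derivatives of `W^x` quadratic in `(x, e)`. -/
theorem abs_fderiv_le {V : NetState d → ℝ} {K : ℝ≥0} (hK : LipschitzWith K (fderiv ℝ V))
    (h0 : fderiv ℝ V 0 = 0) (x v : NetState d) : |fderiv ℝ V x v| ≤ K * ‖x‖ * ‖v‖ := by
  have h1 : ‖fderiv ℝ V x‖ ≤ K * ‖x‖ := by simpa [h0, dist_eq_norm] using hK.dist_le_mul x 0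
  exact ((fderiv ℝ V x).le_opNorm v).trans (mul_le_mul_of_nonneg_right h1 (norm_nonneg v))

theorem abs_inner_coord_le (x v : NetState d) (i : Fin N) :
    |inner ℝ (x i) (v i)| ≤ ‖x‖ * ‖v‖ :=
  (abs_real_inner_le_norm _ _).trans (mul_le_mul (PiLp.norm_apply_le x i) (PiLp.norm_apply_le v i)
    (norm_nonneg _) (norm_nonneg _))

/-- Along the dynamics the derivatives of `W^x` and `W^{xe}` are bounded by a multiple of a common
bound for `‖x‖²` and `‖e‖²`. -/
theorem exists_bound_dWx_dWxe {V : Fin N → NetState d → ℝ} {f : NetState d → NetState d → NetState d}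
    (hVgrad : ∀ i, ∃ K, LipschitzWith K (fderiv ℝ (V i)))
    (hVcrit : ∀ i, fderiv ℝ (V i) 0 = 0) {Lf : ℝ} (hLf : 0 ≤ Lf)
    (hf : ∀ x e, ‖f x e‖ ≤ Lf * (‖x‖ + ‖e‖)) (cα cγ σ r cβ : ℝ) :
    ∃ A : ℝ, 0 ≤ A ∧ ∀ (x e : NetState d) (i : Fin N),
      |dWx V cα σ r cβ x (f x e) i| ≤ A * (‖x‖ ^ 2 + ‖e‖ ^ 2) ∧
      |dWxe V cα cγ σ r cβ x e (f x e) i| ≤ A * (‖x‖ ^ 2 + ‖e‖ ^ 2) := by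
  choose K hK using hVgrad
  set B : ℝ := |(σ - 1) * cα| * 2 + |r + cβ| * ∑ i, (K i : ℝ) with hB
  have hB0 : 0 ≤ B := by
    have : 0 ≤ ∑ i, (K i : ℝ) := Finset.sum_nonneg fun i _ => (K i).2
    positivity
  refine ⟨2 * Lf * (B + |cγ| * 2), by positivity, fun x e i => ?_⟩
  have hKi : (K i : ℝ) ≤ ∑ i, (K i : ℝ) :=
    Finset.single_le_sum (f := fun i => (K i : ℝ)) (fun i _ => (K i).2) (Finset.mem_univ i)
  have h1 : |dWx V cα σ r cβ x (f x e) i| ≤ B * (‖x‖ * ‖f x e‖) := by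
    refine (abs_add_le _ _).trans ?_
    rw [abs_mul ((σ - 1) * cα), abs_mul (2 : ℝ), abs_mul (r + cβ), abs_two]
    have t1 := abs_inner_coord_le x (f x e) i
    have t2 := abs_fderiv_le (hK i) (hVcrit i) x (f x e)
    have t3 : (K i : ℝ) * ‖x‖ * ‖f x e‖ ≤ (∑ i, (K i : ℝ)) * (‖x‖ * ‖f x e‖) := by
      rw [mul_assoc]; gcongr
    have t4 : |(σ - 1) * cα| * (2 * |inner ℝ (x i) (f x e i)|) ≤
        |(σ - 1) * cα| * (2 * (‖x‖ * ‖f x e‖)) := by gcongr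
    have t5 : |r + cβ| * |fderiv ℝ (V i) x (f x e)| ≤
        |r + cβ| * ((∑ i, (K i : ℝ)) * (‖x‖ * ‖f x e‖)) := by
      gcongr; exact t2.trans t3
    rw [hB]; linarith
  have h2 : |dWxe V cα cγ σ r cβ x e (f x e) i| ≤
      B * (‖x‖ * ‖f x e‖) + |cγ| * 2 * (‖e‖ * ‖f x e‖) := by
    refine (abs_add_le _ _).trans (add_le_add h1 ?_)
    rw [abs_mul, abs_mul, abs_two, inner_neg_right, abs_neg, mul_assoc]
    gcongr
    exact abs_inner_coord_le e (f x e) i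
  have hx := norm_nonneg x
  have he := norm_nonneg e
  have h3 : ‖x‖ * ‖f x e‖ ≤ 2 * Lf * (‖x‖ ^ 2 + ‖e‖ ^ 2) := by
    have := mul_le_mul_of_nonneg_left (hf x e) hx
    nlinarith [mul_nonneg hLf (sq_nonneg (‖x‖ - ‖e‖)), mul_nonneg hLf (sq_nonneg ‖x‖),
      mul_nonneg hLf (sq_nonneg ‖e‖)]
  have h4 : ‖e‖ * ‖f x e‖ ≤ 2 * Lf * (‖x‖ ^ 2 + ‖e‖ ^ 2) := by
    have := mul_le_mul_of_nonneg_left (hf x e) he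
    nlinarith [mul_nonneg hLf (sq_nonneg (‖x‖ - ‖e‖)), mul_nonneg hLf (sq_nonneg ‖x‖),
      mul_nonneg hLf (sq_nonneg ‖e‖)]
  have h5 := mul_le_mul_of_nonneg_left h3 hB0
  have h6 := mul_le_mul_of_nonneg_left h4 (by positivity : 0 ≤ |cγ| * 2)
  have h7 : 0 ≤ |cγ| * 2 * (2 * Lf * (‖x‖ ^ 2 + ‖e‖ ^ 2)) := by positivity
  constructor <;> linarith

theorem exists_lipschitz_closedLoop {F : NetState d → Input m → NetState d}
    {κ : NetState d → Input m}
    (hF : ∃ K, LipschitzWith K (fun p : NetState d × Input m => F p.1 p.2))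
    (hκ : ∃ K, LipschitzWith K κ) : ∃ Lf : ℝ, 0 < Lf ∧ ∀ x e x' e',
      ‖closedLoop F κ x e - closedLoop F κ x' e'‖ ≤ Lf * (‖x - x'‖ + ‖e - e'‖) := by
  obtain ⟨K, hK⟩ := hF
  obtain ⟨K', hK'⟩ := hκ
  refine ⟨K * (1 + K') + 1, by positivity, fun x e x' e' => ?_⟩
  have h1 := hK.dist_le_mul (x, κ (x + e)) (x', κ (x' + e'))
  have h2 := hK'.dist_le_mul (x + e) (x' + e')
  rw [Prod.dist_eq] at h1
  simp only [dist_eq_norm] at h1 h2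
  have h3 : ‖x + e - (x' + e')‖ ≤ ‖x - x'‖ + ‖e - e'‖ := by
    rw [add_sub_add_comm]; exact norm_add_le _ _
  have h4 : max ‖x - x'‖ ‖κ (x + e) - κ (x' + e')‖ ≤ (1 + K') * (‖x - x'‖ + ‖e - e'‖) := by
    have := mul_le_mul_of_nonneg_left h3 K'.2
    have p1 := norm_nonneg (x - x')
    have p2 := norm_nonneg (e - e')
    have p3 : 0 ≤ (K' : ℝ) * (‖x - x'‖ + ‖e - e'‖) := by positivity
    simp only [val_eq_coe] at this
    refine max_le ?_ ?_ <;> linarith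
  have h5 := mul_le_mul_of_nonneg_left h4 K.2
  have h6 : 0 ≤ ‖x - x'‖ + ‖e - e'‖ := by positivity
  simp only [val_eq_coe] at h5
  unfold closedLoop
  linarith

/-- Replacing `f x 0` by `f x e` costs at most `c₄ L_f ‖x‖ ‖e‖`, and half of the decay `c₃ ‖x‖²`
absorbs this by Young's inequality. -/
theorem IsExpLyapunov.exists_areRateConstants {f : NetState d → NetState d → NetState d}
    {V : NetState d → ℝ} {c₁ c₂ c₃ c₄ Lf : ℝ} (hV : IsExpLyapunov f V c₁ c₂ c₃ c₄) (hLf : 0 < Lf)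
    (hf : ∀ x e x' e', ‖f x e - f x' e'‖ ≤ Lf * (‖x - x'‖ + ‖e - e'‖)) :
    ∃ cα cγ : ℝ, AreRateConstants f V Lf cα cγ := by
  have p3 := hV.pos₃
  have p4 := hV.pos₄
  refine ⟨c₃ / 2, (c₄ * Lf) ^ 2 / (2 * c₃), hLf, by positivity, by positivity, hf, fun x e => ?_⟩
  have h1 : fderiv ℝ V x (f x e) = fderiv ℝ V x (f x 0) + fderiv ℝ V x (f x e - f x 0) := by
    rw [map_sub]; ring
  have h2 : fderiv ℝ V x (f x e - f x 0) ≤ c₄ * ‖x‖ * (Lf * ‖e‖) := by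
    refine (le_abs_self _).trans (((fderiv ℝ V x).le_opNorm _).trans ?_)
    have := hf x e x 0
    simp only [sub_self, norm_zero, sub_zero, zero_add] at this
    exact mul_le_mul (hV.grad x) this (norm_nonneg _) (by positivity)
  have h3 := hV.decay x
  have h4 : c₄ * ‖x‖ * (Lf * ‖e‖) ≤ c₃ / 2 * ‖x‖ ^ 2 + (c₄ * Lf) ^ 2 / (2 * c₃) * ‖e‖ ^ 2 := by
    have : c₃ / 2 * ‖x‖ ^ 2 + (c₄ * Lf) ^ 2 / (2 * c₃) * ‖e‖ ^ 2 - c₄ * ‖x‖ * (Lf * ‖e‖) =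
        (c₃ * ‖x‖ - c₄ * Lf * ‖e‖) ^ 2 / (2 * c₃) := by field_simp; ring
    have h5 : 0 ≤ (c₃ * ‖x‖ - c₄ * Lf * ‖e‖) ^ 2 / (2 * c₃) := by positivity
    linarith
  linarith

theorem IsExpLyapunov.apply_zero {f : NetState d → NetState d → NetState d}
    {V : NetState d → ℝ} {c₁ c₂ c₃ c₄ : ℝ} (hV : IsExpLyapunov f V c₁ c₂ c₃ c₄) : V 0 = 0 := by
  have h1 := hV.lower 0
  have h2 := hV.upper 0
  simp at h1 h2
  linarith

/-- The origin is an equilibrium of a Lipschitz system with an exponential Lyapunov function. -/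
theorem IsExpLyapunov.equilibrium {f : NetState d → NetState d → NetState d}
    {V : NetState d → ℝ} {c₁ c₂ c₃ c₄ Lf : ℝ} (hV : IsExpLyapunov f V c₁ c₂ c₃ c₄)
    (hd : Differentiable ℝ V) (hLf : 0 < Lf)
    (hf : ∀ x e x' e', ‖f x e - f x' e'‖ ≤ Lf * (‖x - x'‖ + ‖e - e'‖)) : f 0 0 = 0 := by
  set v := f 0 0 with hv
  by_contra hne
  have hvp : 0 < ‖v‖ := norm_pos_iff.2 hne
  have p1 := hV.pos₁
  have p4 := hV.pos₄
  -- Along the ray through `v`, decay and the Lipschitz bound make the slope of `V` at `s` at most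
  -- `c₄ L_f s² ‖v‖²`. The mean value theorem gives `c₁ T² ≤ c₄ L_f s² T` with `s < T`, which this
  -- `T` contradicts.
  set T : ℝ := c₁ / (c₄ * Lf) with hT
  have hTp : 0 < T := by positivity
  have hder : ∀ t : ℝ, HasDerivAt (fun t : ℝ => V (t • v)) (fderiv ℝ V (t • v) v) t := fun t => by
    have h1 : HasDerivAt (fun t : ℝ => t • v) v t := by
      simpa using (hasDerivAt_id t).smul_const v
    exact (hd (t • v)).hasFDerivAt.comp_hasDerivAt t h1
  obtain ⟨s, hs, hslope⟩ := exists_hasDerivAt_eq_slope (fun t : ℝ => V (t • v))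
    (fun t => fderiv ℝ V (t • v) v) hTp (fun t _ => (hder t).continuousAt.continuousWithinAt)
    (fun t _ => hder t)
  have h1 := hV.lower (T • v)
  simp only [zero_smul, hV.apply_zero, sub_zero] at hslope
  rw [norm_smul, Real.norm_of_nonneg hTp.le] at h1
  rw [eq_div_iff hTp.ne'] at hslope
  have hsv : ‖s • v‖ = s * ‖v‖ := by rw [norm_smul, Real.norm_of_nonneg hs.1.le]
  have h2 := hV.decay (s • v)
  have h3 := hV.grad (s • v)
  have h4 := hf 0 0 (s • v) 0
  simp only [zero_sub, norm_neg, sub_self, norm_zero, add_zero] at h4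
  have h5 : fderiv ℝ V (s • v) v = fderiv ℝ V (s • v) (f (s • v) 0) +
      fderiv ℝ V (s • v) (v - f (s • v) 0) := by rw [map_sub]; ring
  have h6 : fderiv ℝ V (s • v) (v - f (s • v) 0) ≤ c₄ * ‖s • v‖ * (Lf * ‖s • v‖) := by
    refine (le_abs_self _).trans (((fderiv ℝ V (s • v)).le_opNorm _).trans ?_)
    exact mul_le_mul h3 h4 (norm_nonneg _) (by positivity)
  rw [hsv] at h2 h6
  have h7 : 0 ≤ c₃ * (s * ‖v‖) ^ 2 := mul_nonneg hV.pos₃.le (sq_nonneg _)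
  have h8 : c₁ * (T * ‖v‖) ^ 2 ≤ c₄ * (s * ‖v‖) * (Lf * (s * ‖v‖)) * T := by
    have : fderiv ℝ V (s • v) v ≤ c₄ * (s * ‖v‖) * (Lf * (s * ‖v‖)) := by linarith
    nlinarith
  have h9 : c₁ = T * (c₄ * Lf) := by rw [hT]; field_simp
  have h10 : c₄ * (s * ‖v‖) * (Lf * (s * ‖v‖)) * T < c₁ * (T * ‖v‖) ^ 2 := by
    have hss : s ^ 2 < T ^ 2 := by nlinarith [hs.1, hs.2]
    have : 0 < T * (c₄ * Lf) * ‖v‖ ^ 2 := by positivity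
    rw [h9]; nlinarith
  linarith

end DistributedETC

/-! ### Estimates on one inter-event interval -/

namespace DistributedETC
open Set Filter Topology NNReal

variable {N m : ℕ} {d : Fin N → ℕ}

/-- The standing assumptions on the constants of the trigger. -/
structure TriggerData (f : NetState d → NetState d → NetState d) (V : Fin N → NetState d → ℝ)
    (c₁ c₂ Lf cα cγ σ r cβ : ℝ) : Prop where
  diff : ∀ i, Differentiable ℝ (V i)
  lower : ∀ x, c₁ * ‖x‖ ^ 2 ≤ aggregate V x
  upper : ∀ x, aggregate V x ≤ c₂ * ‖x‖ ^ 2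
  rate : AreRateConstants f (aggregate V) Lf cα cγ
  equilibrium : f 0 0 = 0
  pos₁ : 0 < c₁
  pos₂ : 0 < c₂
  pos_r : 0 < r
  pos_σ : 0 < σ
  pos_β : 0 < cβ
  slack : 0 < (1 - σ) * cα - r * c₂
  lt_cβ : (1 - σ) * (cα / c₁) - r < cβ

/-- The part of the threshold that is left for the consensus error during the minimal
inter-event time. -/
noncomputable def margin (Lf cα cγ c₂ σ r cβ : ℝ) : ℝ :=
  min (3 * ((1 - σ) * cα - r * c₂) / (4 * c₂))
    (cβ * (1 - Real.exp (-(σ * cα / c₂) * (tauD Lf cα cγ c₂ σ r / 2))))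

/-- One inter-event interval `[a, b]` of the triggered system. -/
structure Phase (G : SimpleGraph (Fin N)) [DecidableRel G.Adj]
    (f : NetState d → NetState d → NetState d) (V : Fin N → NetState d → ℝ)
    (cα cγ σ r cβ ρa ρz V₀ a b : ℝ) (x : ℝ → NetState d) (z α : ℝ → Fin N → ℝ) : Prop where
  x_ode : ∀ s ∈ Icc a b, HasDerivWithinAt x (f (x s) (x a - x s)) (Icc a b) s
  z_ode : ∀ s ∈ Icc a b, HasDerivWithinAt z
    (dWx V cα σ r cβ (x s) (f (x s) (x a - x s)) - ρz • (G.lapMatrix ℝ).mulVec (z s)) (Icc a b) s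
  α_ode : ∀ s ∈ Icc a b, HasDerivWithinAt α
    (dWxe V cα cγ σ r cβ (x s) (x a - x s) (f (x s) (x a - x s))
      - ρa • (G.lapMatrix ℝ).mulVec (α s)) (Icc a b) s
  α_init : α a = z a
  no_trigger : ∀ s ∈ Ico a b, ∀ i, α s i ≠ cβ * V₀ * Real.exp (-r * s) / N

/-- The invariant of the triggered system at the time `s`. -/
structure Invariant (V : Fin N → NetState d → ℝ) (cα σ r cβ μ V₀ s : ℝ) (x : NetState d)
    (z : Fin N → ℝ) : Prop where
  value : aggregate V x ≤ V₀ * Real.exp (-r * s)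
  average : ∑ i, z i = ∑ i, Wx V cα σ r cβ x i
  spread_le : spread z ≤ (μ / (2 * N)) ^ 2 * (V₀ * Real.exp (-r * s)) ^ 2

theorem hasDerivAt_exp_decay (k s : ℝ) :
    HasDerivAt (fun s : ℝ => Real.exp (-k * s)) (Real.exp (-k * s) * -k) s := by
  simpa using ((hasDerivAt_id s).const_mul (-k)).exp

theorem tauD_pos_of_slack {Lf cα cγ c₂ σ r : ℝ} (hL : 0 < Lf) (hγ : 0 < cγ)
    (hs : 0 < (1 - σ) * cα - r * c₂) : 0 < tauD Lf cα cγ c₂ σ r := by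
  have h3 : 0 < √(((1 - σ) * cα - r * c₂) / cγ) := Real.sqrt_pos.2 (by positivity)
  unfold tauD
  positivity

namespace TriggerData

variable {G : SimpleGraph (Fin N)} [DecidableRel G.Adj]
  {f : NetState d → NetState d → NetState d} {V : Fin N → NetState d → ℝ}
  {c₁ c₂ Lf cα cγ σ r cβ : ℝ}

theorem tauD_pos (T : TriggerData f V c₁ c₂ Lf cα cγ σ r cβ) : 0 < tauD Lf cα cγ c₂ σ r :=
  tauD_pos_of_slack T.rate.pos_L T.rate.pos_γ T.slack

theorem margin_pos (T : TriggerData f V c₁ c₂ Lf cα cγ σ r cβ) :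
    0 < margin Lf cα cγ c₂ σ r cβ := by
  have h := T.slack
  have h1 := T.pos₂
  have h2 := T.pos_σ
  have h3 := T.rate.pos_α
  have h4 := T.tauD_pos
  refine lt_min (by positivity) (mul_pos T.pos_β (sub_pos.2 (Real.exp_lt_one_iff.2 ?_)))
  have : 0 < σ * cα / c₂ * (tauD Lf cα cγ c₂ σ r / 2) := by positivity
  linarith

theorem norm_f_le (T : TriggerData f V c₁ c₂ Lf cα cγ σ r cβ) (x e : NetState d) :
    ‖f x e‖ ≤ Lf * (‖x‖ + ‖e‖) := by
  simpa [T.equilibrium] using T.rate.lipschitz x e 0 0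

theorem aggregate_nonneg (T : TriggerData f V c₁ c₂ Lf cα cγ σ r cβ) (x : NetState d) :
    0 ≤ aggregate V x :=
  (mul_nonneg T.pos₁.le (sq_nonneg _)).trans (T.lower x)

theorem hasDerivWithinAt_value (T : TriggerData f V c₁ c₂ Lf cα cγ σ r cβ)
    {x : ℝ → NetState d} {v : NetState d} {S : Set ℝ} {s : ℝ} (hx : HasDerivWithinAt x v S s) :
    HasDerivWithinAt (fun τ => aggregate V (x τ)) (fderiv ℝ (aggregate V) (x s) v) S s :=
  (differentiable_aggregate T.diff (x s)).hasFDerivAt.comp_hasDerivWithinAt s hx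

/-- The trigger condition keeps the Lyapunov function below its prescribed decay. -/
theorem value_le (T : TriggerData f V c₁ c₂ Lf cα cγ σ r cβ) {x : ℝ → NetState d} {a b V₀ : ℝ}
    (hx : ∀ s ∈ Icc a b, HasDerivWithinAt x (f (x s) (x a - x s)) (Icc a b) s)
    (hW : ∀ s ∈ Icc a b, ∑ i, Wxe V cα cγ σ r cβ (x s) (x a - x s) i ≤
      cβ * (V₀ * Real.exp (-r * s)))
    (ha : aggregate V (x a) ≤ V₀ * Real.exp (-r * a)) :
    ∀ s ∈ Icc a b, aggregate V (x s) ≤ V₀ * Real.exp (-r * s) := by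
  have key := nonpos_of_deriv_le_neg_mul (k := r + cβ) (fun s hs =>
    (T.hasDerivWithinAt_value (hx s hs)).fun_sub
      ((hasDerivAt_exp_decay r s).const_mul V₀).hasDerivWithinAt) ?_ (sub_nonpos.2 ha)
  · exact fun s hs => sub_nonpos.1 (key s hs)
  intro s hs
  have h1 := T.rate.dissipation (x s) (x a - x s)
  have h2 := hW s hs
  rw [sum_Wxe] at h2
  have h3 : 0 ≤ σ * cα * ‖x s‖ ^ 2 := by
    have := T.pos_σ; have := T.rate.pos_α; positivity
  linarith

/-- The lower bound on `cβ` is used here: it gives `(1 - σ) cα ‖x‖² ≤ (r + cβ) V`, so a bound on the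
sum of `W^{xe}` controls `‖e‖²`. -/
theorem norm_sq_add_norm_sq_le (T : TriggerData f V c₁ c₂ Lf cα cγ σ r cβ) {x e : NetState d}
    {γ : ℝ} (hW : ∑ i, Wxe V cα cγ σ r cβ x e i ≤ cβ * γ) (hv : aggregate V x ≤ γ) :
    ‖x‖ ^ 2 + ‖e‖ ^ 2 ≤ (1 / c₁ + cβ / cγ) * γ := by
  have p1 := T.pos₁
  have pγ := T.rate.pos_γ
  have h1 := T.lower x
  rw [sum_Wxe] at hW
  have hx : ‖x‖ ^ 2 ≤ 1 / c₁ * γ := by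
    rw [one_div_mul_eq_div, le_div_iff₀ p1]; linarith
  have he : ‖e‖ ^ 2 ≤ cβ / cγ * γ := by
    rw [div_mul_eq_mul_div, le_div_iff₀ pγ]
    have h2 : (1 - σ) * cα * ‖x‖ ^ 2 ≤ (r + cβ) * aggregate V x := by
      have hs : 0 ≤ (1 - σ) * cα := by
        have := T.slack; have := mul_pos T.pos_r T.pos₂; linarith
      have h3 : (1 - σ) * cα / c₁ ≤ r + cβ := by have := T.lt_cβ; rw [mul_div_assoc]; linarith
      have h4 : (1 - σ) * cα / c₁ * aggregate V x ≤ (r + cβ) * aggregate V x :=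
        mul_le_mul_of_nonneg_right h3 (T.aggregate_nonneg x)
      have h5 : (1 - σ) * cα * ‖x‖ ^ 2 = (1 - σ) * cα / c₁ * (c₁ * ‖x‖ ^ 2) := by field_simp
      have h6 : (1 - σ) * cα / c₁ * (c₁ * ‖x‖ ^ 2) ≤ (1 - σ) * cα / c₁ * aggregate V x := by
        gcongr
      linarith
    linarith
  linarith

/-- During the minimal inter-event time `φ(τ) ≤ q`, and `φ(τ) ≤ q / 2` in its first half. -/
theorem error_le (T : TriggerData f V c₁ c₂ Lf cα cγ σ r cβ) {x : ℝ → NetState d} {a b : ℝ}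
    (hx : ∀ s ∈ Icc a b, HasDerivWithinAt x (f (x s) (x a - x s)) (Icc a b) s)
    (hb : b - a ≤ tauD Lf cα cγ c₂ σ r) {s : ℝ} (hs : s ∈ Icc a b) :
    cγ * ‖x a - x s‖ ^ 2 ≤ ((1 - σ) * cα - r * c₂) * ‖x s‖ ^ 2 ∧
    (s - a ≤ tauD Lf cα cγ c₂ σ r / 2 →
      cγ * ‖x a - x s‖ ^ 2 ≤ ((1 - σ) * cα - r * c₂) / 4 * ‖x s‖ ^ 2) := by
  have hL := T.rate.pos_L
  have hγ := T.rate.pos_γ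
  set D := (1 - σ) * cα - r * c₂ with hD
  have hD0 : 0 < D := T.slack
  set q := √(D / cγ) with hq
  have hq0 : 0 < q := Real.sqrt_pos.2 (by positivity)
  have hq2 : cγ * q ^ 2 = D := by rw [hq, Real.sq_sqrt (by positivity)]; field_simp
  have hτ : Lf * tauD Lf cα cγ c₂ σ r * (1 + q) = q := by
    unfold tauD; rw [← hD, ← hq]; field_simp
  set τ := tauD Lf cα cγ c₂ σ r with hτd
  have hτ0 : 0 < τ := T.tauD_pos
  have hLb : Lf * (b - a) ≤ 1 := by
    have h1 : Lf * (b - a) ≤ Lf * τ := by gcongr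
    nlinarith [mul_pos hL hτ0]
  have hw := norm_error_le hL.le hLb hx (fun u _ => T.norm_f_le _ _) s hs
  have hu := norm_nonneg (x s)
  have hv := norm_nonneg (x a - x s)
  set u := ‖x s‖
  set w := ‖x a - x s‖
  -- From `w ≤ Lf (s - a) (u + w)` follows `(1 + p) w ≤ p (u + w)`. By `hτ`, `p = q` is admissible
  -- up to `τ`, and `p = q / 2` up to `τ / 2`.
  have key : ∀ p : ℝ, 0 < p → Lf * (s - a) * (1 + p) ≤ p → w ≤ p * u := fun p hp h => by
    have h1 := mul_le_mul_of_nonneg_right h (add_nonneg hu hv)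
    have h2 : w * (1 + p) ≤ Lf * (s - a) * (u + w) * (1 + p) :=
      mul_le_mul_of_nonneg_right hw (by linarith)
    linarith
  constructor
  · have h1 : w ≤ q * u := key q hq0 (by
      have : Lf * (s - a) * (1 + q) ≤ Lf * τ * (1 + q) := by
        gcongr; linarith [hs.2]
      linarith)
    have h2 : w ^ 2 ≤ (q * u) ^ 2 := by gcongr
    rw [← hq2]
    nlinarith
  · intro hhalf
    have h1 : w ≤ q / 2 * u := key (q / 2) (by positivity) (by
      have : Lf * (s - a) * (1 + q / 2) ≤ Lf * (τ / 2) * (1 + q) := by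
        have : 0 ≤ s - a := sub_nonneg.2 hs.1
        gcongr; linarith
      linarith)
    have h2 : w ^ 2 ≤ (q / 2 * u) ^ 2 := by gcongr
    rw [← hq2]
    nlinarith

/-- During the minimal inter-event time the average stays strictly below the threshold. -/
theorem sum_Wxe_le (T : TriggerData f V c₁ c₂ Lf cα cγ σ r cβ) {x : ℝ → NetState d} {a b V₀ : ℝ}
    (hx : ∀ s ∈ Icc a b, HasDerivWithinAt x (f (x s) (x a - x s)) (Icc a b) s)
    (hb : b - a ≤ tauD Lf cα cγ c₂ σ r) (hV₀ : 0 ≤ V₀)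
    (hv : ∀ s ∈ Icc a b, aggregate V (x s) ≤ V₀ * Real.exp (-r * s)) {s : ℝ} (hs : s ∈ Icc a b) :
    ∑ i, Wxe V cα cγ σ r cβ (x s) (x a - x s) i ≤
      (cβ - margin Lf cα cγ c₂ σ r cβ) * (V₀ * Real.exp (-r * s)) := by
  have p2 := T.pos₂
  have pr := T.pos_r
  have pσ := T.pos_σ
  have pα := T.rate.pos_α
  have pβ := T.pos_β
  have hslack := T.slack
  have hup := T.upper (x s)
  have hg : 0 ≤ V₀ * Real.exp (-r * s) := by positivity
  obtain ⟨hfull, hhalf⟩ := T.error_le hx hb hs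
  rw [sum_Wxe]
  set τ := tauD Lf cα cγ c₂ σ r with hτ
  have hμ1 : margin Lf cα cγ c₂ σ r cβ ≤ 3 * ((1 - σ) * cα - r * c₂) / (4 * c₂) := min_le_left _ _
  have hμ2 : margin Lf cα cγ c₂ σ r cβ ≤ cβ * (1 - Real.exp (-(σ * cα / c₂) * (τ / 2))) :=
    min_le_right _ _
  set μ := margin Lf cα cγ c₂ σ r cβ
  rcases le_total (s - a) (τ / 2) with h | h
  -- In the first half the error uses only a quarter of the slack; the other three quarters give the
  -- first term of `margin`.
  · have h1 := hhalf h
    have h2 : 3 * ((1 - σ) * cα - r * c₂) / (4 * c₂) * aggregate V (x s) ≤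
        3 * ((1 - σ) * cα - r * c₂) / (4 * c₂) * (c₂ * ‖x s‖ ^ 2) := by gcongr
    have h3 : 3 * ((1 - σ) * cα - r * c₂) / (4 * c₂) * (c₂ * ‖x s‖ ^ 2) =
        3 / 4 * ((1 - σ) * cα - r * c₂) * ‖x s‖ ^ 2 := by field_simp
    have h4 := mul_le_mul_of_nonneg_right hμ1 (T.aggregate_nonneg (x s))
    have h5 : r * aggregate V (x s) ≤ r * (c₂ * ‖x s‖ ^ 2) := by gcongr
    have h6 : 0 ≤ cβ - μ := by
      have : 0 < cβ * Real.exp (-(σ * cα / c₂) * (τ / 2)) := by positivity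
      linarith
    have h7 := mul_le_mul_of_nonneg_left (hv s hs) h6
    linarith
  -- In the second half the slack may be exhausted. But `σ > 0` has made `V` decay at the rate `r +
  -- k` since `a`, and the factor gained over time `τ / 2` is the second term of `margin`.
  · set k := σ * cα / c₂ with hk
    have hk0 : 0 < k := by positivity
    have key := nonpos_of_deriv_le_neg_mul (k := r + k) (fun u hu =>
      (T.hasDerivWithinAt_value (hx u hu)).fun_sub
        ((hasDerivAt_exp_decay (r + k) u).const_mul
          (aggregate V (x a) * Real.exp ((r + k) * a))).hasDerivWithinAt) ?_ ?_ s hs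
    · have h1 : Real.exp ((r + k) * a) * Real.exp (-(r + k) * s) =
          Real.exp (r * a) * Real.exp (-r * s) * Real.exp (-k * (s - a)) := by
        simp only [← Real.exp_add]; congr 1; ring
      have h2 : Real.exp (-k * (s - a)) ≤ Real.exp (-k * (τ / 2)) :=
        Real.exp_le_exp.2 (by nlinarith)
      have h3 : aggregate V (x a) * Real.exp (r * a) ≤ V₀ := by
        have := mul_le_mul_of_nonneg_right (hv a ⟨le_rfl, hs.1.trans hs.2⟩)
          (Real.exp_pos (r * a)).le
        rwa [mul_assoc, ← Real.exp_add, neg_mul, neg_add_cancel, Real.exp_zero, mul_one] at this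
      have h4 : aggregate V (x s) ≤ V₀ * Real.exp (-r * s) * Real.exp (-k * (τ / 2)) := by
        calc aggregate V (x s)
            ≤ aggregate V (x a) * Real.exp ((r + k) * a) * Real.exp (-(r + k) * s) := by linarith
          _ = (aggregate V (x a) * Real.exp (r * a)) * Real.exp (-r * s)
              * Real.exp (-k * (s - a)) := by
                rw [mul_assoc, h1]; ring
          _ ≤ V₀ * Real.exp (-r * s) * Real.exp (-k * (τ / 2)) := by gcongr
      have h5 : r * aggregate V (x s) ≤ r * (c₂ * ‖x s‖ ^ 2) := by gcongr
      have h6 := mul_le_mul_of_nonneg_left h4 pβ.le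
      have h7 := mul_le_mul_of_nonneg_right hμ2 hg
      linarith
    · intro u hu
      have h1 := T.rate.dissipation (x u) (x a - x u)
      have h2 := (T.error_le hx hb hu).1
      have h3 : (r + k) * aggregate V (x u) ≤ (r + k) * (c₂ * ‖x u‖ ^ 2) := by
        gcongr; exact T.upper _
      have h4 : k * (c₂ * ‖x u‖ ^ 2) = σ * cα * ‖x u‖ ^ 2 := by rw [hk]; field_simp
      linarith
    · rw [mul_assoc, ← Real.exp_add, neg_mul, add_neg_cancel, Real.exp_zero, mul_one, sub_self]

/-- The average lies below the threshold by at least `margin * γ / N`, and an entry exceeds the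
average by at most half of that. -/
theorem lt_threshold (T : TriggerData f V c₁ c₂ Lf cα cγ σ r cβ) {γ : ℝ} (hγ : 0 < γ)
    {y : Fin N → ℝ} (hsum : ∑ i, y i ≤ (cβ - margin Lf cα cγ c₂ σ r cβ) * γ)
    (hspread : spread y ≤ (margin Lf cα cγ c₂ σ r cβ / (2 * N)) ^ 2 * γ ^ 2) (i : Fin N) :
    y i < cβ * γ / N := by
  have hμ := T.margin_pos
  set μ := margin Lf cα cγ c₂ σ r cβ
  have hN : (0 : ℝ) < N := by have := i.pos; positivity
  rw [← mul_pow] at hspread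
  have h1 := le_average_add_sqrt_spread y (by positivity) hspread i
  have h2 : (∑ j, y j) / N ≤ (cβ - μ) * γ / N := by gcongr
  have h3 : (cβ - μ) * γ / N + μ / (2 * N) * γ = cβ * γ / N - μ * γ / (2 * N) := by
    field_simp; ring
  have h4 : 0 < μ * γ / (2 * N) := by positivity
  linarith

/-- The invariant propagates through an inter-event interval, and no trigger occurs during the
minimal inter-event time. -/
theorem invariant_of_phase (T : TriggerData f V c₁ c₂ Lf cα cγ σ r cβ)
    {A gap ρa ρz V₀ a b : ℝ} {x : ℝ → NetState d} {z α : ℝ → Fin N → ℝ}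
    (hA0 : 0 ≤ A)
    (hA : ∀ (x e : NetState d) (i : Fin N),
      |dWx V cα σ r cβ x (f x e) i| ≤ A * (‖x‖ ^ 2 + ‖e‖ ^ 2) ∧
      |dWxe V cα cγ σ r cβ x e (f x e) i| ≤ A * (‖x‖ ^ 2 + ‖e‖ ^ 2))
    (hgap0 : 0 < gap)
    (hgap : ∀ δ : Fin N → ℝ, ∑ i, δ i = 0 →
      gap * ∑ i, δ i ^ 2 ≤ dotProduct δ ((G.lapMatrix ℝ).mulVec δ))
    (hρ : ∀ ρ, ρ = ρa ∨ ρ = ρz → 0 < ρ ∧ N * (A * (1 / c₁ + cβ / cγ)) ^ 2 / (ρ * gap) +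
      2 * r * (margin Lf cα cγ c₂ σ r cβ / (2 * N)) ^ 2 ≤
        ρ * gap * (margin Lf cα cγ c₂ σ r cβ / (2 * N)) ^ 2)
    (hV₀ : 0 < V₀) (P : Phase G f V cα cγ σ r cβ ρa ρz V₀ a b x z α)
    (ha : Invariant V cα σ r cβ (margin Lf cα cγ c₂ σ r cβ) V₀ a (x a) (z a)) :
    ∀ s ∈ Icc a b, Invariant V cα σ r cβ (margin Lf cα cγ c₂ σ r cβ) V₀ s (x s) (z s) ∧
      (s - a ≤ tauD Lf cα cγ c₂ σ r → ∀ i, α s i < cβ * V₀ * Real.exp (-r * s) / N) := by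
  intro s₀ hs₀
  have hab : a ∈ Icc a b := ⟨le_rfl, hs₀.1.trans hs₀.2⟩
  have hN : ∀ i : Fin N, (0 : ℝ) < N := fun i => by have := i.pos; positivity
  have hWxe : ∀ s ∈ Icc a b, HasDerivWithinAt
      (fun τ => Wxe V cα cγ σ r cβ (x τ) (x a - x τ)) _ (Icc a b) s := fun s hs =>
    hasDerivWithinAt_Wxe T.diff cα cγ σ r cβ (P.x_ode s hs) (x a)
  have hinit : ∑ i, α a i = ∑ i, Wxe V cα cγ σ r cβ (x a) (x a - x a) i := by
    rw [P.α_init, ha.average, sum_Wx, sum_Wxe]; simp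
  have hsumα := sum_eq_of_consensus G hWxe P.α_ode hinit
  have hsumz := sum_eq_of_consensus G
    (fun s hs => hasDerivWithinAt_Wx T.diff cα σ r cβ (P.x_ode s hs)) P.z_ode ha.average
  -- The dwell-time estimate on the degenerate interval `[a, a]` gives strictness just after the
  -- reset.
  have hstart : ∀ i, α a i < cβ * V₀ * Real.exp (-r * a) / N := by
    intro i
    rw [mul_assoc]
    refine T.lt_threshold (by positivity) ?_ (P.α_init ▸ ha.spread_le) i
    rw [hinit]
    have hsub : Icc a a ⊆ Icc a b := Icc_subset_Icc le_rfl hab.2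
    refine T.sum_Wxe_le (b := a) (fun s hs => (P.x_ode s (hsub hs)).mono hsub)
      (by simpa using T.tauD_pos.le) hV₀.le (fun s hs => ?_) ⟨le_rfl, le_rfl⟩
    obtain rfl : s = a := le_antisymm hs.2 hs.1
    exact ha.value
  -- Exceeding the threshold at `s` would force a crossing strictly before `s`, hence before `b`,
  -- where no trigger occurs.
  have hbelow : ∀ s ∈ Icc a b, ∀ i, α s i ≤ cβ * V₀ * Real.exp (-r * s) / N := by
    intro s hs i
    by_contra hc
    push Not at hc
    have hcont : ContinuousOn (fun u => α u i - cβ * V₀ * Real.exp (-r * u) / N) (Icc a s) := by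
      have h1 : ContinuousOn (fun u => α u i) (Icc a s) := fun u hu =>
        (hasDerivWithinAt_pi.1 (P.α_ode u ⟨hu.1, hu.2.trans hs.2⟩) i).continuousWithinAt.mono
          (Icc_subset_Icc le_rfl hs.2)
      fun_prop
    obtain ⟨u, hu, hu0⟩ := intermediate_value_Ioo hs.1 hcont
      (show (0 : ℝ) ∈ Ioo _ _ from ⟨sub_neg.2 (hstart i), sub_pos.2 hc⟩)
    exact P.no_trigger u ⟨hu.1.le, hu.2.trans_le hs.2⟩ i (sub_eq_zero.1 hu0)
  have hW : ∀ s ∈ Icc a b, ∑ i, Wxe V cα cγ σ r cβ (x s) (x a - x s) i ≤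
      cβ * (V₀ * Real.exp (-r * s)) := by
    intro s hs
    rw [← hsumα s hs]
    refine (Finset.sum_le_sum fun i _ => hbelow s hs i).trans ?_
    rw [Finset.sum_const, Finset.card_univ, Fintype.card_fin, nsmul_eq_mul, ← mul_assoc]
    rcases Nat.eq_zero_or_pos N with rfl | h
    · have := T.pos_β
      simp only [CharP.cast_eq_zero, zero_mul]; positivity
    · exact (mul_div_cancel₀ _ (by positivity)).le
  have hval := T.value_le P.x_ode hW ha.value
  have hbd : ∀ s ∈ Icc a b, A * (‖x s‖ ^ 2 + ‖x a - x s‖ ^ 2) ≤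
      A * (1 / c₁ + cβ / cγ) * (V₀ * Real.exp (-r * s)) := fun s hs => by
    rw [mul_assoc]
    exact mul_le_mul_of_nonneg_left (T.norm_sq_add_norm_sq_le (hW s hs) (hval s hs)) hA0
  obtain ⟨hz1, hz2⟩ := hρ ρz (Or.inr rfl)
  obtain ⟨ha1, ha2⟩ := hρ ρa (Or.inl rfl)
  have hsz := spread_le_of_consensus G hgap0 hgap hz1 hz2 P.z_ode
    (fun s hs i => ((hA _ _ i).1).trans (hbd s hs)) ha.spread_le
  have hsα := spread_le_of_consensus G hgap0 hgap ha1 ha2 P.α_ode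
    (fun s hs i => ((hA _ _ i).2).trans (hbd s hs)) (by rw [P.α_init]; exact ha.spread_le)
  refine ⟨⟨hval s₀ hs₀, hsumz s₀ hs₀, hsz s₀ hs₀⟩, fun hτ i => ?_⟩
  rw [mul_assoc]
  refine T.lt_threshold (by positivity) ?_ (hsα s₀ hs₀) i
  rw [hsumα s₀ hs₀]
  have hsub : Icc a s₀ ⊆ Icc a b := Icc_subset_Icc le_rfl hs₀.2
  exact T.sum_Wxe_le (b := s₀) (fun s hs => (P.x_ode s (hsub hs)).mono hsub) hτ hV₀.le
    (fun s hs => hval s (hsub hs)) ⟨hs₀.1, le_rfl⟩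

end TriggerData

/-- The right side grows linearly in `ρ` while the left side decreases. The chosen `ρ₀` also makes
`ρ * gap ≥ 1`, so the division can be dropped. -/
theorem exists_gain (n C β gap r : ℝ) (hn : 0 ≤ n) (hβ : 0 < β) (hgap : 0 < gap) (hr : 0 < r) :
    ∃ ρ₀ : ℝ, 0 < ρ₀ ∧ ∀ ρ, ρ₀ ≤ ρ →
      0 < ρ ∧ n * C ^ 2 / (ρ * gap) + 2 * r * β ≤ ρ * gap * β := by
  have h0 : 0 < (1 + 2 * r + n * C ^ 2 / β) / gap := by positivity
  refine ⟨_, h0, fun ρ hρ => ⟨h0.trans_le hρ, ?_⟩⟩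
  rw [div_le_iff₀ hgap] at hρ
  have h1 : 0 ≤ n * C ^ 2 / β := by positivity
  have h2 : n * C ^ 2 / (ρ * gap) ≤ n * C ^ 2 := div_le_self (by positivity) (by linarith)
  have h3 := mul_le_mul_of_nonneg_right hρ hβ.le
  have h4 : n * C ^ 2 / β * β = n * C ^ 2 := div_mul_cancel₀ _ hβ.ne'
  nlinarith

end DistributedETC

/-! ### Existence of executions -/

namespace DistributedETC
open Set Filter Topology NNReal

section Hybrid

variable {S : Type*} (Φ : ℝ → S → ℝ → S) (Trig : ℝ → S → Set ℝ)

open Classical in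
/-- The next update time of a hybrid system with flow `Φ` and trigger set `Trig`, together with the
state at that time. -/
noncomputable def hybridStep (p : EReal × S) : EReal × S :=
  if p.1 = ⊤ ∨ Trig p.1.toReal p.2 = ∅ then (⊤, p.2)
  else ((sInf (Trig p.1.toReal p.2) : ℝ), Φ p.1.toReal p.2 (sInf (Trig p.1.toReal p.2)))

variable {Φ Trig}

/-- Closedness and the lower bound `a` make the infimum of a nonempty trigger set a least element.
-/
theorem hybridStep_of_coe (hcl : ∀ a p, IsClosed (Trig a p)) (hsub : ∀ a p, Trig a p ⊆ Ici a)
    (a : ℝ) (p : S) :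
    (hybridStep Φ Trig (a, p) = (⊤, p) ∧ Trig a p = ∅) ∨
    ∃ b : ℝ, a ≤ b ∧ hybridStep Φ Trig (a, p) = ((b : EReal), Φ a p b) ∧ IsLeast (Trig a p) b := by
  rcases (Trig a p).eq_empty_or_nonempty with h | h
  · left; simp [hybridStep, h]
  · right
    have hbdd : BddBelow (Trig a p) := ⟨a, fun s hs => hsub a p hs⟩
    have hmem : sInf (Trig a p) ∈ Trig a p := (hcl a p).csInf_mem h hbdd
    refine ⟨sInf (Trig a p), hsub a p hmem, ?_, hmem, fun s hs => csInf_le hbdd hs⟩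
    simp [hybridStep, h.ne_empty]

/-- A hybrid system with globally defined flow has a run from every initial state. -/
theorem exists_hybrid_run (hΦ : ∀ a p, Φ a p a = p) (hcl : ∀ a p, IsClosed (Trig a p))
    (hsub : ∀ a p, Trig a p ⊆ Ici a) (p₀ : S) :
    ∃ (t : ℕ → EReal) (p : ℕ → S) (y : ℝ → S), t 0 = 0 ∧ Monotone t ∧ p 0 = p₀ ∧ y 0 = p₀ ∧
      (∀ k, t k ≠ ⊥) ∧
      (∀ k, ∀ s ∈ timeInterval t k, y s = Φ (t k).toReal (p k) s) ∧
      (∀ k, ∀ s : ℝ, t k ≤ (s : EReal) → (s : EReal) < t (k + 1) → s ∉ Trig (t k).toReal (p k)) ∧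
      (∀ k, ∀ s : ℝ, (s : EReal) = t (k + 1) → s ∈ Trig (t k).toReal (p k)) := by
  let st : ℕ → EReal × S := fun n => (hybridStep Φ Trig)^[n] (0, p₀)
  have hst : ∀ n, st (n + 1) = hybridStep Φ Trig (st n) := fun n =>
    Function.iterate_succ_apply' _ _ _
  have htop : ∀ n, (st n).1 = ⊤ → (st (n + 1)).1 = ⊤ := fun n h => by
    rw [hst]; simp [hybridStep, h]
  have hbot : ∀ n, (st n).1 ≠ ⊥ := by
    intro n
    cases n with
    | zero => simp [st]
    | succ n => rw [hst]; unfold hybridStep; split_ifs <;> simp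
  have hcase : ∀ n, (st n).1 = ⊤ ∨ ∃ a : ℝ, (st n).1 = a := fun n => by
    by_cases h : (st n).1 = ⊤
    · exact Or.inl h
    · exact Or.inr ⟨_, (EReal.coe_toReal h (hbot n)).symm⟩
  have hreal : ∀ n (a : ℝ), (st n).1 = a →
      ((st (n + 1)).1 = ⊤ ∧ Trig a (st n).2 = ∅) ∨
      ∃ b : ℝ, a ≤ b ∧ st (n + 1) = ((b : EReal), Φ a (st n).2 b) ∧
        IsLeast (Trig a (st n).2) b := by
    intro n a h
    have h1 : st n = ((a : EReal), (st n).2) := Prod.ext h rfl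
    rw [hst]
    rcases hybridStep_of_coe (Φ := Φ) hcl hsub a (st n).2 with ⟨h2, h3⟩ | ⟨b, h2, h3, h4⟩
    · exact Or.inl ⟨by rw [h1, h2], h3⟩
    · exact Or.inr ⟨b, h2, by rw [h1, h3], h4⟩
  have hmono : Monotone fun n => (st n).1 := by
    refine monotone_nat_of_le_succ fun n => ?_
    rcases hcase n with h | ⟨a, h⟩
    · rw [htop n h]; exact le_top
    · rcases hreal n a h with ⟨h1, _⟩ | ⟨b, h1, h2, _⟩
      · rw [h1]; exact le_top
      · rw [h, h2]; exact EReal.coe_le_coe_iff.2 h1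
  have hnext : ∀ n (b : ℝ), (b : EReal) = (st (n + 1)).1 →
      (st (n + 1)).2 = Φ (st n).1.toReal (st n).2 b ∧
        IsLeast (Trig (st n).1.toReal (st n).2) b := by
    intro n b hb
    rcases hcase n with h | ⟨a, h⟩
    · rw [htop n h] at hb; exact absurd hb (EReal.coe_ne_top b)
    · rcases hreal n a h with ⟨h1, _⟩ | ⟨b', h1, h2, h3⟩
      · rw [h1] at hb; exact absurd hb (EReal.coe_ne_top b)
      · rw [h2] at hb
        obtain rfl := EReal.coe_injective hb
        rw [h2, h]; exact ⟨rfl, h3⟩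
  -- Distinct intervals meet only at update times, where the next flow restarts from the value
  -- reached. Repeated update times are allowed, hence the induction.
  have hglue : ∀ k j, k ≤ j → ∀ s : ℝ, s ∈ timeInterval (fun n => (st n).1) k →
      s ∈ timeInterval (fun n => (st n).1) j →
      Φ (st k).1.toReal (st k).2 s = Φ (st j).1.toReal (st j).2 s := by
    intro k j hkj
    induction j, hkj using Nat.le_induction with
    | base => exact fun _ _ _ => rfl
    | succ j hkj ih =>
      intro s hs hs'
      have heq : (s : EReal) = (st (j + 1)).1 :=
        le_antisymm (hs.2.trans (hmono (Nat.succ_le_succ hkj))) hs'.1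
      have hj : s ∈ timeInterval (fun n => (st n).1) j :=
        ⟨(hmono (Nat.le_succ j)).trans heq.ge, heq.le⟩
      rw [ih s hs hj, ← (hnext j s heq).1, ← heq, EReal.toReal_coe, hΦ]
  classical
  let y : ℝ → S := fun s => if h : ∃ k, s ∈ timeInterval (fun n => (st n).1) k then
    Φ (st h.choose).1.toReal (st h.choose).2 s else p₀
  have hy : ∀ k, ∀ s ∈ timeInterval (fun n => (st n).1) k,
      y s = Φ (st k).1.toReal (st k).2 s := by
    intro k s hs
    have h : ∃ k, s ∈ timeInterval (fun n => (st n).1) k := ⟨k, hs⟩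
    simp only [y, dif_pos h]
    rcases le_total h.choose k with h' | h'
    · exact hglue _ _ h' s h.choose_spec hs
    · exact (hglue _ _ h' s hs h.choose_spec).symm
  refine ⟨fun n => (st n).1, fun n => (st n).2, y, rfl, hmono, rfl, ?_, hbot, hy, ?_, ?_⟩
  · rw [hy 0 0 ⟨le_rfl, hmono (Nat.zero_le 1)⟩]
    simp only [st, Function.iterate_zero, id, EReal.toReal_zero, hΦ]
  · intro k s h1 h2 hmem
    beta_reduce at h1 h2
    rcases hcase k with h | ⟨a, h⟩
    · rw [h] at h1; exact EReal.coe_ne_top s (top_le_iff.1 h1)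
    · simp only [h, EReal.toReal_coe] at hmem
      rcases hreal k a h with ⟨_, h4⟩ | ⟨b, _, h4, h5⟩
      · rw [h4] at hmem; exact hmem
      · have h6 := h5.2 hmem
        rw [h4] at h2
        exact absurd (EReal.coe_lt_coe_iff.1 h2) (not_lt.2 h6)
  · exact fun k s hs => (hnext k s hs).2.1

end Hybrid

variable {N m : ℕ} {d : Fin N → ℕ}

/-- Dynamic average consensus has a solution for every differentiable reference signal. -/
theorem exists_consensus_solution (G : SimpleGraph (Fin N)) [DecidableRel G.Adj] (ρ a : ℝ)
    {w w' : ℝ → Fin N → ℝ} (hw : ∀ s ∈ Ici a, HasDerivWithinAt w (w' s) (Ici a) s)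
    (z₀ : Fin N → ℝ) :
    ∃ z : ℝ → Fin N → ℝ, z a = z₀ ∧ ∀ s ∈ Ici a,
      HasDerivWithinAt z (w' s - ρ • (G.lapMatrix ℝ).mulVec (z s)) (Ici a) s := by
  set M : (Fin N → ℝ) →L[ℝ] (Fin N → ℝ) :=
    LinearMap.toContinuousLinearMap (Matrix.mulVecLin (G.lapMatrix ℝ)) with hM
  have hMv : ∀ y, M y = (G.lapMatrix ℝ).mulVec y := fun y => rfl
  have hwc : Continuous fun t => w (max t a) := by
    have h1 : ContinuousOn w (Ici a) := fun s hs => (hw s hs).continuousWithinAt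
    exact h1.comp_continuous (by fun_prop) fun t => le_max_right t a
  -- The unknown `ζ = z - w` removes `w'`, so only continuity of `w` is needed; `max t a` extends
  -- `w` to the whole line.
  obtain ⟨ζ, hζ0, hζ⟩ := exists_global_solution_of_lipschitz (K := ‖(-ρ) • M‖₊)
    (v := fun t y => ((-ρ) • M) (y + w (max t a)))
    (fun t => by
      have h := ((-ρ) • M).lipschitz.comp (LipschitzWith.id.add (LipschitzWith.const (w (max t a))))
      rwa [add_zero, mul_one] at h)
    (fun y => ((-ρ) • M).continuous.comp (continuous_const.add hwc)) a (z₀ - w a)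
  refine ⟨fun s => ζ s + w s, by simp [hζ0], fun s hs => ((hζ s hs).fun_add (hw s hs)).congr_deriv ?_⟩
  rw [max_eq_left hs, ← hMv]
  simp only [_root_.smul_apply, neg_smul]
  abel

/-- With the sample fixed the system is a cascade: `x` evolves autonomously and drives two consensus
equations. -/
theorem exists_flow (G : SimpleGraph (Fin N)) [DecidableRel G.Adj]
    {f : NetState d → NetState d → NetState d} {V : Fin N → NetState d → ℝ} {Lf : ℝ} (hLf : 0 ≤ Lf)
    (hf : ∀ x e x' e', ‖f x e - f x' e'‖ ≤ Lf * (‖x - x'‖ + ‖e - e'‖))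
    (hV : ∀ i, Differentiable ℝ (V i)) (cα cγ σ r cβ ρa ρz a : ℝ)
    (p : NetState d × (Fin N → ℝ)) :
    ∃ (x : ℝ → NetState d) (z α : ℝ → Fin N → ℝ), x a = p.1 ∧ z a = p.2 ∧ α a = p.2 ∧
      (∀ s ∈ Ici a, HasDerivWithinAt x (f (x s) (p.1 - x s)) (Ici a) s) ∧
      (∀ s ∈ Ici a, HasDerivWithinAt z
        (dWx V cα σ r cβ (x s) (f (x s) (p.1 - x s)) - ρz • (G.lapMatrix ℝ).mulVec (z s))
        (Ici a) s) ∧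
      ∀ s ∈ Ici a, HasDerivWithinAt α
        (dWxe V cα cγ σ r cβ (x s) (p.1 - x s) (f (x s) (p.1 - x s))
          - ρa • (G.lapMatrix ℝ).mulVec (α s)) (Ici a) s := by
  obtain ⟨x, hx0, hx⟩ := exists_global_solution_of_lipschitz (K := ⟨2 * Lf, by positivity⟩)
    (v := fun _ y => f y (p.1 - y)) (fun _ => LipschitzWith.of_dist_le_mul fun y y' => by
      have h := hf y (p.1 - y) y' (p.1 - y')
      rw [sub_sub_sub_cancel_left, norm_sub_rev y' y] at h
      rw [dist_eq_norm, dist_eq_norm]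
      change _ ≤ 2 * Lf * ‖y - y'‖
      linarith) (fun y => continuous_const) a p.1
  obtain ⟨z, hz0, hz⟩ := exists_consensus_solution G ρz a
    (fun s hs => hasDerivWithinAt_Wx hV cα σ r cβ (hx s hs)) p.2
  obtain ⟨α, hα0, hα⟩ := exists_consensus_solution G ρa a
    (fun s hs => hasDerivWithinAt_Wxe hV cα cγ σ r cβ (hx s hs) p.1) p.2
  exact ⟨x, z, α, hx0, hz0, hα0, hx, hz, hα⟩

/-- Executions of the distributed trigger exist. -/
theorem nonempty_execution (G : SimpleGraph (Fin N)) [DecidableRel G.Adj]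
    {F : NetState d → Input m → NetState d} {κ : NetState d → Input m}
    {V : Fin N → NetState d → ℝ} {Lf : ℝ} (hLf : 0 ≤ Lf)
    (hf : ∀ x e x' e', ‖closedLoop F κ x e - closedLoop F κ x' e'‖ ≤
      Lf * (‖x - x'‖ + ‖e - e'‖))
    (hV : ∀ i, Differentiable ℝ (V i)) (cα cγ σ r cβ ρa ρz : ℝ) (x₀ : NetState d) :
    Nonempty (Execution G F κ V cα cγ σ r cβ ρa ρz x₀) := by
  -- The state of the hybrid system is the pair `(x, z)`. The estimate `a` restarts from `z` at each
  -- update, so it only enters the trigger sets.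
  choose X Z A hX0 hZ0 hA0 hX hZ hA using fun a p =>
    exists_flow G (V := V) hLf hf hV cα cγ σ r cβ ρa ρz a p
  set thr : ℝ → ℝ := fun s => cβ * aggregate V x₀ * Real.exp (-r * s) / N with hthr
  obtain ⟨t, p, y, ht0, htm, hp0, hy0, hbot, hy, hno, hyes⟩ := exists_hybrid_run
    (Φ := fun a p s => (X a p s, Z a p s)) (Trig := fun a p => {s | a ≤ s ∧ ∃ i, A a p s i = thr s})
    (fun a p => Prod.ext (hX0 a p) (hZ0 a p))
    (fun a p => by
      have h1 : {s | a ≤ s ∧ ∃ i, A a p s i = thr s} =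
          ⋃ i, (Ici a ∩ (fun s => A a p s i - thr s) ⁻¹' {0}) := by
        ext s
        simp [sub_eq_zero]
      rw [h1]
      refine isClosed_iUnion_of_finite fun i => ?_
      refine ContinuousOn.preimage_isClosed_of_isClosed ?_ isClosed_Ici isClosed_singleton
      have h2 : ContinuousOn (fun s => A a p s i) (Ici a) := fun s hs =>
        (hasDerivWithinAt_pi.1 (hA a p s hs) i).continuousWithinAt
      fun_prop)
    (fun a p s hs => hs.1) (x₀, fun _ => (∑ j, Wx V cα σ r cβ x₀ j) / N)
  have hcoe : ∀ k, ∀ s ∈ timeInterval t k, t k = ((t k).toReal : EReal) := fun k s hs =>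
    (EReal.coe_toReal (hs.1.trans_lt (EReal.coe_lt_top s)).ne (hbot k)).symm
  have hsub : ∀ k, ∀ s ∈ timeInterval t k, timeInterval t k ⊆ Ici (t k).toReal :=
    fun k s hs u hu => by
      have := hu.1
      rw [hcoe k s hs] at this
      exact EReal.coe_le_coe_iff.1 this
  have hstart : ∀ k, ∀ s ∈ timeInterval t k, (y (t k).toReal).1 = (p k).1 := fun k s hs => by
    rw [hy k _ ⟨(hcoe k s hs).le, (hcoe k s hs).symm.le.trans (htm (Nat.le_succ k))⟩]
    exact hX0 _ _
  have hxd : ∀ k, ∀ s ∈ timeInterval t k, HasDerivWithinAt (fun s => (y s).1)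
      (closedLoop F κ (y s).1 ((y (t k).toReal).1 - (y s).1)) (timeInterval t k) s := by
    intro k s hs
    rw [hstart k s hs, hy k s hs]
    exact ((hX _ _ s (hsub k s hs hs)).mono (hsub k s hs)).congr
      (fun u hu => by rw [hy k u hu]) (by rw [hy k s hs])
  -- When two update times coincide the interval is a point: `derivWithin` is then uninformative,
  -- but any derivative is valid.
  have hsing : ∀ k, ∀ s ∈ timeInterval t k, ¬UniqueDiffWithinAt ℝ (timeInterval t k) s →
      (timeInterval t k).Subsingleton := by
    intro k s hs hn
    by_contra hns
    rw [not_subsingleton_iff] at hns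
    obtain ⟨u, hu, v, hv, huv⟩ := hns.exists_lt
    have hconv : OrdConnected (timeInterval t k) := ⟨fun u hu v hv w hw =>
      ⟨hu.1.trans (EReal.coe_le_coe_iff.2 hw.1), (EReal.coe_le_coe_iff.2 hw.2).trans hv.2⟩⟩
    have hint : (interior (timeInterval t k)).Nonempty := by
      refine (nonempty_Ioo.2 huv).mono (interior_maximal ?_ isOpen_Ioo)
      exact Ioo_subset_Icc_self.trans (hconv.out hu hv)
    exact hn (uniqueDiffOn_convex hconv.convex hint s hs)
  refine ⟨⟨t, fun s => (y s).1, fun s => (y s).2, fun k => A (t k).toReal (p k), ht0, htm,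
    by simp [hy0], hxd, fun i => by simp [hy0], ?_, ?_, ?_, ?_, ?_⟩⟩
  · intro k s hs
    by_cases hu : UniqueDiffWithinAt ℝ (timeInterval t k) s
    · rw [(hasDerivWithinAt_Wx hV cα σ r cβ (hxd k s hs)).derivWithin hu, hstart k s hs, hy k s hs]
      exact ((hZ _ _ s (hsub k s hs hs)).mono (hsub k s hs)).congr
        (fun u hu => by rw [hy k u hu]) (by rw [hy k s hs])
    · exact HasFDerivWithinAt.of_subsingleton (hsing k s hs hu)
  · intro k s hs
    have hmem : s ∈ timeInterval t k := ⟨hs.ge, hs.le.trans (htm (Nat.le_succ k))⟩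
    rw [hy k s hmem, ← hs, EReal.toReal_coe, hA0, hZ0]
  · intro k s hs
    by_cases hu : UniqueDiffWithinAt ℝ (timeInterval t k) s
    · rw [(hasDerivWithinAt_Wxe hV cα cγ σ r cβ (hxd k s hs) _).derivWithin hu, hstart k s hs,
        hy k s hs]
      exact (hA _ _ s (hsub k s hs hs)).mono (hsub k s hs)
    · exact HasFDerivWithinAt.of_subsingleton (hsing k s hs hu)
  · intro k s h1 h2 i hi
    have hmem : s ∈ timeInterval t k := ⟨h1, h2.le⟩
    exact hno k s h1 h2 ⟨hsub k s hmem hmem, i, hi⟩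
  · exact fun k s hs => (hyes k s hs).2

end DistributedETC

/-! ### Properties of every execution -/

namespace DistributedETC
open Set Filter Topology NNReal

variable {N m : ℕ} {d : Fin N → ℕ} {G : SimpleGraph (Fin N)} [DecidableRel G.Adj]
  {F : NetState d → Input m → NetState d} {κ : NetState d → Input m}
  {V : Fin N → NetState d → ℝ} {c₁ c₂ Lf cα cγ σ r cβ ρa ρz : ℝ} {x₀ : NetState d}

namespace Execution

theorem t_nonneg (E : Execution G F κ V cα cγ σ r cβ ρa ρz x₀) (k : ℕ) : 0 ≤ E.t k :=
  E.t_zero ▸ E.t_mono (Nat.zero_le k)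

theorem eq_coe_of_le (E : Execution G F κ V cα cγ σ r cβ ρa ρz x₀) {k : ℕ} {s : ℝ}
    (h : E.t k ≤ (s : EReal)) : ∃ a : ℝ, E.t k = a :=
  ⟨_, (EReal.coe_toReal (h.trans_lt (EReal.coe_lt_top s)).ne
    (EReal.bot_lt_zero.trans_le (E.t_nonneg k)).ne').symm⟩

/-- The end `b` may precede the next update, so the interval estimates also apply when `t_{k+1}` is
infinite. -/
theorem phase (E : Execution G F κ V cα cγ σ r cβ ρa ρz x₀) (hV : ∀ i, Differentiable ℝ (V i))
    {k : ℕ} {a b : ℝ} (ha : E.t k = a) (hb : (b : EReal) ≤ E.t (k + 1)) :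
    Phase G (closedLoop F κ) V cα cγ σ r cβ ρa ρz (aggregate V x₀) a b E.x E.z (E.a k) := by
  have hsub : Icc a b ⊆ timeInterval E.t k := fun s hs =>
    ⟨ha.le.trans (EReal.coe_le_coe_iff.2 hs.1), (EReal.coe_le_coe_iff.2 hs.2).trans hb⟩
  have hreal : (E.t k).toReal = a := by rw [ha, EReal.toReal_coe]
  have hx := E.x_ode k
  have hz := E.z_ode k
  have hα := E.a_ode k
  rw [hreal] at hx hα
  have hu : a < b → ∀ s ∈ Icc a b, UniqueDiffWithinAt ℝ (timeInterval E.t k) s :=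
    fun hab s hs => (uniqueDiffOn_Icc hab s hs).mono hsub
  have hcases : a < b ∨ (Icc a b).Subsingleton := (lt_or_ge a b).imp_right subsingleton_Icc_of_ge
  refine ⟨fun s hs => (hx s (hsub hs)).mono hsub, fun s hs => ?_, fun s hs => ?_,
    E.a_jump k a ha.symm, fun s hs i => ?_⟩
  · rcases hcases with hab | hab
    · have h := hz s (hsub hs)
      rw [(hasDerivWithinAt_Wx hV cα σ r cβ (hx s (hsub hs))).derivWithin (hu hab s hs)] at h
      exact h.mono hsub
    · exact HasFDerivWithinAt.of_subsingleton hab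
  · rcases hcases with hab | hab
    · have h := hα s (hsub hs)
      rw [(hasDerivWithinAt_Wxe hV cα cγ σ r cβ (hx s (hsub hs)) _).derivWithin (hu hab s hs)] at h
      exact h.mono hsub
    · exact HasFDerivWithinAt.of_subsingleton hab
  · exact E.no_trigger_before k s (hsub ⟨hs.1, hs.2.le⟩).1
      ((EReal.coe_lt_coe_iff.2 hs.2).trans_le hb) i

/-- An execution from the origin never leaves the time `0`. -/
theorem t_eq_zero (E : Execution G F κ V cα cγ σ r cβ ρa ρz 0) (hN : 0 < N)
    (hV0 : aggregate V 0 = 0) (k : ℕ) : E.t k = 0 := by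
  induction k with
  | zero => exact E.t_zero
  | succ k ih =>
    refine le_antisymm (not_lt.1 fun h => ?_) (E.t_nonneg _)
    -- The threshold and the reset value of `a` both vanish, so the trigger fires again at once.
    refine E.no_trigger_before k 0 (by simp [ih]) (by simpa using h) ⟨0, hN⟩ ?_
    rw [E.a_jump k 0 (by simp [ih]), E.z_zero, sum_Wx, hV0]
    simp

variable (E : Execution G F κ V cα cγ σ r cβ ρa ρz x₀) {μ τ : ℝ}
  (hN : 0 < N) (hV : ∀ i, Differentiable ℝ (V i))
  (hstep : ∀ (a b : ℝ) (x : ℝ → NetState d) (z α : ℝ → Fin N → ℝ),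
    Phase G (closedLoop F κ) V cα cγ σ r cβ ρa ρz (aggregate V x₀) a b x z α →
    Invariant V cα σ r cβ μ (aggregate V x₀) a (x a) (z a) →
    ∀ s ∈ Icc a b, Invariant V cα σ r cβ μ (aggregate V x₀) s (x s) (z s) ∧
      (s - a ≤ τ → ∀ i, α s i < cβ * aggregate V x₀ * Real.exp (-r * s) / N))

include hN hV hstep

/-- At time `0` all entries of `z` equal the exact average, so the spread is zero; each phase then
hands the invariant to the next. -/
theorem invariant_at (k : ℕ) : ∀ a : ℝ, E.t k = a →
    Invariant V cα σ r cβ μ (aggregate V x₀) a (E.x a) (E.z a) := by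
  induction k with
  | zero =>
    intro a ha
    obtain rfl : a = 0 := EReal.coe_injective (ha.symm.trans E.t_zero)
    have hne : (N : ℝ) ≠ 0 := by positivity
    have hsum : ∑ i, E.z 0 i = ∑ i, Wx V cα σ r cβ x₀ i := by
      simp only [E.z_zero, Finset.sum_const, Finset.card_univ, Fintype.card_fin, nsmul_eq_mul]
      field_simp
    refine ⟨by simp [E.x_zero], by rw [E.x_zero, hsum], ?_⟩
    have : spread (E.z 0) = 0 := by
      unfold spread
      rw [hsum]
      simp [E.z_zero]
    rw [this]
    positivity
  | succ k ih =>
    intro b hb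
    obtain ⟨a, ha⟩ := E.eq_coe_of_le ((E.t_mono (Nat.le_succ k)).trans hb.le)
    have hab : a ≤ b := by
      have := E.t_mono (Nat.le_succ k)
      rw [ha, hb] at this
      exact EReal.coe_le_coe_iff.1 this
    exact (hstep a b _ _ _ (E.phase hV ha hb.symm.le) (ih a ha) b ⟨hab, le_rfl⟩).1

theorem value_le {k : ℕ} {s : ℝ} (hs : s ∈ timeInterval E.t k) :
    aggregate V (E.x s) ≤ aggregate V x₀ * Real.exp (-r * s) := by
  obtain ⟨a, ha⟩ := E.eq_coe_of_le hs.1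
  have has : a ≤ s := by
    have := hs.1
    rw [ha] at this
    exact EReal.coe_le_coe_iff.1 this
  exact (hstep a s _ _ _ (E.phase hV ha hs.2) (E.invariant_at hN hV hstep k a ha) s
    ⟨has, le_rfl⟩).1.value

/-- A finite update time needs equality with the threshold, which the strict inequality of `hstep`
forbids up to `τ`. -/
theorem add_le_next (k : ℕ) : E.t k + (τ : EReal) ≤ E.t (k + 1) := by
  by_cases htop : E.t (k + 1) = ⊤
  · rw [htop]; exact le_top
  have hb : E.t (k + 1) = ((E.t (k + 1)).toReal : EReal) := (EReal.coe_toReal htop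
    (EReal.bot_lt_zero.trans_le (E.t_nonneg _)).ne').symm
  set b := (E.t (k + 1)).toReal
  obtain ⟨a, ha⟩ := E.eq_coe_of_le ((E.t_mono (Nat.le_succ k)).trans hb.le)
  have hab : a ≤ b := by
    have := E.t_mono (Nat.le_succ k)
    rw [ha, hb] at this
    exact EReal.coe_le_coe_iff.1 this
  rw [ha, hb, ← EReal.coe_add, EReal.coe_le_coe_iff]
  by_contra hc
  push Not at hc
  obtain ⟨i, hi⟩ := E.trigger_at k b hb.symm
  exact ((hstep a b _ _ _ (E.phase hV ha hb.symm.le) (E.invariant_at hN hV hstep k a ha) b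
    ⟨hab, le_rfl⟩).2 (by linarith) i).ne hi

theorem exists_mem_interval (hτ : 0 < τ) (s : ℝ) (hs : 0 ≤ s) :
    ∃ k, E.t k ≤ (s : EReal) ∧ (s : EReal) < E.t (k + 1) := by
  have hgrow : ∀ k : ℕ, ((k * τ : ℝ) : EReal) ≤ E.t k := by
    intro k
    induction k with
    | zero => simp [E.t_zero]
    | succ k ih =>
      refine le_trans ?_ (E.add_le_next hN hV hstep k)
      rw [Nat.cast_succ, add_mul, one_mul, EReal.coe_add]
      gcongr
  obtain ⟨n, hn⟩ := exists_nat_gt (s / τ)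
  rw [div_lt_iff₀ hτ] at hn
  have hex : ∃ k, (s : EReal) < E.t k := ⟨n, (EReal.coe_lt_coe_iff.2 hn).trans_le (hgrow n)⟩
  classical
  have hpos : Nat.find hex ≠ 0 := fun h => by
    have h1 := Nat.find_spec hex
    rw [h, E.t_zero] at h1
    exact absurd (EReal.coe_lt_coe_iff.1 h1) (not_lt.2 hs)
  obtain ⟨k, hk⟩ := Nat.exists_eq_succ_of_ne_zero hpos
  refine ⟨k, not_lt.1 (Nat.find_min hex (by omega)), ?_⟩
  have h1 := Nat.find_spec hex
  rwa [hk] at h1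

end Execution

end DistributedETC

/-! ### The main theorem -/

open DistributedETC in
theorem mainTheorem1 {N m : ℕ} {d : Fin N → ℕ}
    (G : SimpleGraph (Fin N)) [DecidableRel G.Adj] (hG : G.Connected)
    (F : NetState d → Input m → NetState d) (κ : NetState d → Input m)
    (V : Fin N → NetState d → ℝ) (c₁ c₂ c₃ c₄ : ℝ)
    (hF : ∃ K, LipschitzWith K (fun p : NetState d × Input m => F p.1 p.2))
    (hκ : ∃ K, LipschitzWith K κ)
    (hVlocal : ∀ i, IsLocalAt G i (V i))
    (hVdiff : ∀ i, ContDiff ℝ 1 (V i))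
    (hVgrad : ∀ i, ∃ K, LipschitzWith K (fderiv ℝ (V i)))
    (hVcrit : ∀ i, fderiv ℝ (V i) 0 = 0)
    (hV : IsExpLyapunov (closedLoop F κ) (aggregate V) c₁ c₂ c₃ c₄) :
    (∃ Lf cα cγ : ℝ, AreRateConstants (closedLoop F κ) (aggregate V) Lf cα cγ) ∧
    ∀ Lf cα cγ : ℝ, AreRateConstants (closedLoop F κ) (aggregate V) Lf cα cγ →
    ∀ r σ cβ : ℝ, 0 < r → r < cα / c₂ → 0 < σ → σ < 1 - r * c₂ / cα →
      (1 - σ) * (cα / c₁) - r < cβ →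
      0 < tauD Lf cα cγ c₂ σ r ∧
      ∃ ρa₀ ρz₀ : ℝ, 0 < ρa₀ ∧ 0 < ρz₀ ∧ ∀ ρa ρz : ℝ, ρa₀ ≤ ρa → ρz₀ ≤ ρz →
        (∀ x₀ : NetState d, Nonempty (Execution G F κ V cα cγ σ r cβ ρa ρz x₀)) ∧
        (∀ x₀ : NetState d, x₀ ≠ 0 → ∀ E : Execution G F κ V cα cγ σ r cβ ρa ρz x₀,
          (∀ k, E.t k + (tauD Lf cα cγ c₂ σ r : ℝ) ≤ E.t (k + 1)) ∧
          (∀ s : ℝ, 0 ≤ s → ∃ k, E.t k ≤ (s : EReal) ∧ (s : EReal) < E.t (k + 1)) ∧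
          (∀ s : ℝ, 0 ≤ s → aggregate V (E.x s) ≤ aggregate V x₀ * Real.exp (-r * s))) ∧
        GloballyExpStable G F κ V cα cγ σ r cβ ρa ρz := by
  have hdiff : ∀ i, Differentiable ℝ (V i) := fun i => (hVdiff i).differentiable one_ne_zero
  refine ⟨?_, fun Lf cα cγ R r σ cβ hr hrα hσ hσ1 hcβ => ?_⟩
  · obtain ⟨Lf, hLf, hf⟩ := exists_lipschitz_closedLoop hF hκ
    exact ⟨Lf, hV.exists_areRateConstants hLf hf⟩
  have p1 := hV.pos₁
  have p2 := hV.pos₂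
  have pα := R.pos_α
  have hslack : 0 < (1 - σ) * cα - r * c₂ := by
    have h1 : r * c₂ / cα < 1 - σ := by linarith
    rw [div_lt_iff₀ pα] at h1
    linarith
  have hτ := tauD_pos_of_slack R.pos_L R.pos_γ hslack
  have heq : closedLoop F κ 0 0 = 0 :=
    hV.equilibrium (differentiable_aggregate hdiff) R.pos_L R.lipschitz
  have hne := fun ρa ρz x₀ =>
    nonempty_execution G R.pos_L.le R.lipschitz hdiff cα cγ σ r cβ ρa ρz x₀
  refine ⟨hτ, ?_⟩
  have hN : 0 < N := by
    obtain ⟨i⟩ := hG.nonempty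
    exact i.pos
  -- If all agents have dimension zero, `c₁ ≤ c₂` can fail and `cβ` need not be positive; the claims
  -- are then immediate.
  rcases subsingleton_or_nontrivial (NetState d) with hsub | hnt
  · refine ⟨1, 1, one_pos, one_pos, fun ρa ρz _ _ => ⟨hne ρa ρz,
      fun x₀ hx₀ => absurd (Subsingleton.elim _ _) hx₀, heq, 1, 1, one_pos, one_pos, ?_⟩⟩
    intro x₀ E k s _
    rw [Subsingleton.elim (E.x s) 0, norm_zero]
    positivity
  have hc12 : c₁ ≤ c₂ := by
    obtain ⟨x, hx⟩ := exists_ne (0 : NetState d)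
    have h1 : 0 < ‖x‖ ^ 2 := by have := norm_pos_iff.2 hx; positivity
    exact le_of_mul_le_mul_right ((hV.lower x).trans (hV.upper x)) h1
  have pβ : 0 < cβ := by
    have h1 : r * c₂ < (1 - σ) * cα := by linarith
    have h2 : r * c₁ ≤ r * c₂ := by gcongr
    have h3 : r < (1 - σ) * (cα / c₁) := by
      rw [← mul_div_assoc, lt_div_iff₀ p1]; linarith
    linarith
  have T : TriggerData (closedLoop F κ) V c₁ c₂ Lf cα cγ σ r cβ :=
    ⟨hdiff, hV.lower, hV.upper, R, heq, p1, p2, hr, hσ, pβ, hslack, hcβ⟩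
  obtain ⟨A, hA0, hA⟩ := exists_bound_dWx_dWxe hVgrad hVcrit R.pos_L.le T.norm_f_le cα cγ σ r cβ
  obtain ⟨gap, hgap0, hgap⟩ := exists_spectral_gap G hG
  have hμ := T.margin_pos
  obtain ⟨ρ₀, hρ₀, hgain⟩ := exists_gain N (A * (1 / c₁ + cβ / cγ))
    ((margin Lf cα cγ c₂ σ r cβ / (2 * N)) ^ 2) gap r (by positivity) (by positivity) hgap0 hr
  refine ⟨ρ₀, ρ₀, hρ₀, hρ₀, fun ρa ρz hρa hρz => ?_⟩
  have hpos : ∀ x₀ : NetState d, x₀ ≠ 0 → 0 < aggregate V x₀ := fun x₀ hx₀ => by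
    have := norm_pos_iff.2 hx₀
    exact (by positivity : 0 < c₁ * ‖x₀‖ ^ 2).trans_le (hV.lower x₀)
  have hstep := fun (x₀ : NetState d) (hx₀ : x₀ ≠ 0) a b x z α =>
    T.invariant_of_phase (G := G) (ρa := ρa) (ρz := ρz) (a := a) (b := b) (x := x) (z := z) (α := α)
      hA0 hA hgap0 hgap (by rintro ρ (rfl | rfl) <;> exact hgain _ ‹_›) (hpos x₀ hx₀)
  -- The constants are the square roots of those in `c₁ ‖x‖² ≤ V ≤ c₂ ‖x₀‖² exp(-r s)`.
  refine ⟨hne ρa ρz, fun x₀ hx₀ E => ?_, heq, √(c₂ / c₁), r / 2, by positivity, by positivity,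
    fun x₀ E k s hs => ?_⟩
  · have hmem := E.exists_mem_interval hN hdiff (hstep x₀ hx₀) hτ
    refine ⟨E.add_le_next hN hdiff (hstep x₀ hx₀), hmem, fun s hs => ?_⟩
    obtain ⟨k, h1, h2⟩ := hmem s hs
    exact E.value_le hN hdiff (hstep x₀ hx₀) ⟨h1, h2.le⟩
  · rcases eq_or_ne x₀ 0 with rfl | hx₀
    · have h0 := E.t_eq_zero hN hV.apply_zero
      obtain rfl : s = 0 := by
        have h1 := hs.1
        have h2 := hs.2
        rw [h0] at h1 h2
        exact EReal.coe_injective (le_antisymm h2 h1)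
      simp [E.x_zero]
    · have h1 := E.value_le hN hdiff (hstep x₀ hx₀) hs
      have h2 := hV.lower (E.x s)
      have h3 : aggregate V x₀ * Real.exp (-r * s) ≤ c₂ * ‖x₀‖ ^ 2 * Real.exp (-r * s) := by
        gcongr; exact hV.upper x₀
      refine le_of_sq_le_sq ?_ (by positivity)
      rw [mul_pow, mul_pow, Real.sq_sqrt (by positivity), ← Real.exp_nat_mul]
      have h4 : ((2 : ℕ) : ℝ) * (-(r / 2) * s) = -r * s := by push_cast; ring
      rw [h4, div_mul_eq_mul_div, div_mul_eq_mul_div, le_div_iff₀ p1]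
      linarith
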